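/- **Theorem 1.3.** Let $\{r_n\}_{n\ge 0}$, $\{q_n\}_{n\ge 0}$ be real sequences with $r_n>0$ for all $n\ge 0$, let $\{\sigma_n\}_{n\ge 0}$ be a complex sequence, and put $\Delta a_n=a_{n+1}-a_n$. Let $u=\{u_n\}_{n\ge0}$ and $v=\{v_n\}_{n\ge0}$ be real solutions of $$\Delta(r_{n-1}\Delta z_{n-1})=q_nz_n,\qquad n\ge 1,$$ such that $u_n>0$, $v_n>0$ and $r_n(v_{n+1}u_n-u_{n+1}v_n)=1$ for all $n\ge 0$, and $$\lim_{n\to\infty}\frac{u_n}{v_n}=0,\qquad \sum_{n=0}^\infty\frac1{r_nu_nu_{n+1}}=\infty,\qquad \sum_{n=0}^\infty\frac1{r_nv_nv_{n+1}}<\infty$$ (so $u$ is a principal and $v$ a non-principal solution). The *narrow Hartman–Wintner problem* is called solvable if there are two linearly independent complex solutions $\tilde u=\{\tilde u_n\}_{n\ge0}$, $\tilde v=\{\tilde v_n\}_{n\ge0}$ of $$\Delta(r_{n-1}\Delta y_{n-1})=(q_n+\sigma_n)y_n,\qquad n\ge 1,$$ such that $$\lim_{n\to\infty}\frac{\tilde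 u_n}{u_n}=\lim_{n\to\infty}\frac{\tilde v_n}{v_n}=1,$$ $$\frac{\tilde u_{n+1}}{\tilde u_n}=\frac{u_{n+1}}{u_n}+o\Big(\frac1{r_nu_nv_n}\Big),\qquad \frac{\tilde v_{n+1}}{\tilde v_n}=\frac{v_{n+1}}{v_n}+o\Big(\frac1{r_nu_nv_n}\Big)\qquad(n\to\infty),$$ $$\sum_{n=0}^\infty r_nu_nv_{n+1}\left|\frac{\tilde u_{n+1}}{u_{n+1}}-\frac{\tilde u_n}{u_n}\right|^2<\infty .$$ Whenever the series on the right converge (at least conditionally), put $$J_m=\sum_{k=m}^\infty\sigma_ku_kv_k,\qquad C_n=\frac{v_n}{u_n}\sum_{k=n}^\infty\sigma_ku_k^2 ;$$ if the series $J=\sum_{k=0}^\infty\sigma_ku_kv_k$ converges, then all $J_m$ and $C_n$ are defined. Then the narrow Hartman–Wintner problem is solvable if and only if the series $J$ converges (at least conditionally) and at least one of the following two conditions holds: - the series $G=\displaystyle\sum_{n=0}^\infty\frac{|C_{n+1}|^2}{r_nu_nv_{n+1}}$ converges; - the series $L=\displaystyle\sum_{n=0}^\infty\frac{\operatorname{Re}\big(J_{n+1}\overline{C_{n+1}}\big)}{r_nu_nv_{n+1}}$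 converges (at least conditionally). -/

import Mathlib

open Filter Topology Asymptotics SummationFilter ComplexConjugate

namespace HartmanWintner

/-- `y` solves the difference equation `Δ(r_{n-1} Δ y_{n-1}) = p_n y_n` for `n = 1, 2, …`, where
`Δ a_n = a_{n+1} - a_n`. The index is shifted by one (`n + 1` in place of `n`), so that only the
terms of the sequences `r`, `p`, `y` on `ℕ` occur. -/
def IsSolution {𝕜 : Type*} [Ring 𝕜] [Module ℝ 𝕜] (r : ℕ → ℝ) (p y : ℕ → 𝕜) : Prop :=
  ∀ n : ℕ, fwdDiff 1 (fun k => r k • fwdDiff 1 y k) n = p (n + 1) * y (n + 1)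

/-- `(u, v)` is a pair of positive solutions of the unperturbed equation
`Δ(r_{n-1} Δ z_{n-1}) = q_n z_n`, with `u` the principal (recessive) and `v` a non-principal
(dominant) solution, normalized by `r_n (v_{n+1} u_n - u_{n+1} v_n) = 1`. -/
structure IsPrincipalPair (r q u v : ℕ → ℝ) : Prop where
  sol_u : IsSolution r q u
  sol_v : IsSolution r q v
  pos_u : ∀ n, 0 < u n
  pos_v : ∀ n, 0 < v n
  casoratian : ∀ n, r n * (v (n + 1) * u n - u (n + 1) * v n) = 1
  tendsto_ratio : Tendsto (fun n => u n / v n) atTop (𝓝 0)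
  not_summable_u : ¬ Summable (fun n => 1 / (r n * u n * u (n + 1)))
  summable_v : Summable (fun n => 1 / (r n * v n * v (n + 1)))

/-- `(u', v')` is a fundamental system of solutions of the perturbed equation
`Δ(r_{n-1} Δ y_{n-1}) = (q_n + σ_n) y_n`, i.e. two linearly independent solutions of this
second order linear equation. -/
structure IsFundamentalSystem (r q : ℕ → ℝ) (σ u' v' : ℕ → ℂ) : Prop where
  sol_u : IsSolution r (fun n => (q n : ℂ) + σ n) u'
  sol_v : IsSolution r (fun n => (q n : ℂ) + σ n) v'
  linearIndependent : LinearIndependent ℂ ![u', v']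

/-- The asymptotic relations that the Hartman–Wintner problem asks of a fundamental system
`(u', v')` of the perturbed equation, relative to the system `(u, v)` of the unperturbed one. -/
structure HasHartmanWintnerAsymptotics (r u v : ℕ → ℝ) (u' v' : ℕ → ℂ) : Prop where
  tendsto_u : Tendsto (fun n => u' n / (u n : ℂ)) atTop (𝓝 1)
  tendsto_v : Tendsto (fun n => v' n / (v n : ℂ)) atTop (𝓝 1)
  isLittleO_u :
    (fun n => u' (n + 1) / u' n - ((u (n + 1) / u n : ℝ) : ℂ))
      =o[atTop] fun n => 1 / (r n * u n * v n)
  isLittleO_v :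
    (fun n => v' (n + 1) / v' n - ((v (n + 1) / v n : ℝ) : ℂ))
      =o[atTop] fun n => 1 / (r n * u n * v n)

/-- The narrow Hartman–Wintner problem is solvable: the perturbed equation has a fundamental system
of solutions with the Hartman–Wintner asymptotics which moreover satisfies
`∑ r_n u_n v_{n+1} |u'_{n+1} / u_{n+1} - u'_n / u_n|² < ∞`. -/
def NarrowProblemSolvable (r q : ℕ → ℝ) (σ : ℕ → ℂ) (u v : ℕ → ℝ) : Prop :=
  ∃ u' v' : ℕ → ℂ,
    IsFundamentalSystem r q σ u' v' ∧
    HasHartmanWintnerAsymptotics r u v u' v' ∧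
    Summable (fun n =>
      r n * u n * v (n + 1) * ‖u' (n + 1) / (u (n + 1) : ℂ) - u' n / (u n : ℂ)‖ ^ 2)

/-- The series `J = ∑_{n ≥ 0} σ_n u_n v_n` converges, at least conditionally, that is, its
sequence of partial sums converges. -/
def ConvergesJ (σ : ℕ → ℂ) (u v : ℕ → ℝ) : Prop :=
  Summable (fun n => σ n * (u n : ℂ) * (v n : ℂ)) (conditional ℕ)

/-- The remainder `J_m = ∑_{k ≥ m} σ_k u_k v_k`, the limit of the partial sums. -/
noncomputable def J (σ : ℕ → ℂ) (u v : ℕ → ℝ) (m : ℕ) : ℂ :=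
  ∑'[conditional ℕ] k, σ (m + k) * (u (m + k) : ℂ) * (v (m + k) : ℂ)

/-- The sequence `C_n = (v_n / u_n) ∑_{k ≥ n} σ_k u_k²`, the sum being the limit of the partial
sums; this limit exists when `J` converges and `u` is principal. -/
noncomputable def C (σ : ℕ → ℂ) (u v : ℕ → ℝ) (n : ℕ) : ℂ :=
  ((v n / u n : ℝ) : ℂ) * ∑'[conditional ℕ] k, σ (n + k) * (u (n + k) : ℂ) ^ 2

/-- The series `G = ∑_{n ≥ 0} |C_{n+1}|² / (r_n u_n v_{n+1})` converges (its terms are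
nonnegative, so there is only one notion of convergence). -/
def ConvergesG (r : ℕ → ℝ) (σ : ℕ → ℂ) (u v : ℕ → ℝ) : Prop :=
  Summable (fun n => ‖C σ u v (n + 1)‖ ^ 2 / (r n * u n * v (n + 1)))

/-- The series `L = ∑_{n ≥ 0} Re (J_{n+1} conj C_{n+1}) / (r_n u_n v_{n+1})` converges, at least
conditionally. -/
def ConvergesL (r : ℕ → ℝ) (σ : ℕ → ℂ) (u v : ℕ → ℝ) : Prop :=
  Summable (fun n =>
    (J σ u v (n + 1) * conj (C σ u v (n + 1))).re / (r n * u n * v (n + 1))) (conditional ℕ)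

end HartmanWintner

/-! Put ρ = v/u, which increases to infinity, s = σu², z = y/u and w = Δz/Δρ. The perturbed equation
becomes the system Δz_n = Δρ_n w_n, w_{n+1} − w_n = s_{n+1} z_{n+1}. For the recessive solution the
problem asks that z → 1, ρw → 0 and ∑ Δρ_n ρ_{n+1} |w_n|² < ∞. Abel summation turns convergence of J
= ∑ ρs into tails S of ∑ s with C = ρS → 0, and G becomes ∑ Δρ_n ρ_{n+1} |S_{n+1}|².

Necessity: dividing the second equation by z_{n+1} writes ρs as a telescoping term, minus a
logarithmic difference of z, plus an absolutely summable term (`IsSystem.summable_weighted`). The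
quantity e_n = w_n + S_{n+1} z_{n+1} varies so slowly that a Hardy-type inequality bounds it in the
weighted square norm by w, hence S too (`IsSystem.summable_sq_tail`).

Sufficiency: in terms of z and e the system has linear coefficients ±c, c_n = Δρ_n S_{n+1}. The
series ∑ c converges conditionally and ∑ |c|² converges, so the products of 1 ± c converge and
remove these terms. The remaining coupling is absolutely summable and a contraction solves it
(`exists_recessive`). Reduction of order gives the dominant solution (`IsSystem.exists_dominant`).

G and L are equivalent once J converges: J − C is the tail of the series of C_{n+1} Δρ_n/ρ_{n+1},
and telescoping |J − C|² compares the two (`summable_re_mul_conj_iff`). -/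

namespace HartmanWintner

/-! ### Remainders of conditionally convergent series -/

/-- `F` is the sequence of remainders of the convergent series with terms `f`. -/
def IsTail {E : Type*} [AddCommGroup E] [TopologicalSpace E] (F f : ℕ → E) : Prop :=
  (∀ n, F n - F (n + 1) = f n) ∧ Tendsto F atTop (𝓝 0)

theorem hasSum_conditional_iff {E : Type*} [AddCommGroup E] [TopologicalSpace E] {f : ℕ → E}
    {a : E} : HasSum f a (conditional ℕ) ↔
      Tendsto (fun n => ∑ i ∈ Finset.range n, f i) atTop (𝓝 a) := by
  rw [HasSum, conditional_filter_eq_map_range, tendsto_map'_iff]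
  rfl

theorem IsTail.hasSum {E : Type*} [NormedAddCommGroup E] {F f : ℕ → E}
    (h : IsTail F f) (n : ℕ) : HasSum (fun k => f (n + k)) (F n) (conditional ℕ) := by
  rw [hasSum_conditional_iff]
  have key : ∀ m, ∑ i ∈ Finset.range m, f (n + i) = F n - F (m + n) := by
    intro m
    induction m with
    | zero => simp
    | succ m ih =>
      rw [Finset.sum_range_succ, ih, ← h.1, show m + 1 + n = n + m + 1 by ring,
        show m + n = n + m by ring]
      abel
  simp only [key]
  simpa using tendsto_const_nhds.sub ((tendsto_add_atTop_iff_nat n).2 h.2)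

theorem summable_conditional_iff {E : Type*} [NormedAddCommGroup E] {f : ℕ → E} :
    Summable f (conditional ℕ) ↔ ∃ F, IsTail F f := by
  constructor
  · rintro ⟨a, ha⟩
    rw [hasSum_conditional_iff] at ha
    refine ⟨fun n => a - ∑ i ∈ Finset.range n, f i, fun n => ?_, ?_⟩
    · simp [Finset.sum_range_succ]
    · simpa using tendsto_const_nhds (x := a) |>.sub ha
  · rintro ⟨F, hF⟩
    exact ⟨F 0, by simpa using hF.hasSum 0⟩

theorem summable_conditional_iff_of_nonneg {f : ℕ → ℝ} (hf : ∀ n, 0 ≤ f n) :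
    Summable f (conditional ℕ) ↔ Summable f := by
  constructor
  · rintro ⟨a, ha⟩
    rw [hasSum_conditional_iff] at ha
    exact ⟨a, (hasSum_iff_tendsto_nat_of_nonneg hf a).2 ha⟩
  · rintro ⟨a, ha⟩
    exact ⟨a, hasSum_conditional_iff.2 ha.tendsto_sum_nat⟩

theorem isTail_of_summable {E : Type*} [NormedAddCommGroup E] {f : ℕ → E} (hf : Summable f) :
    IsTail (fun n => ∑' k, f (k + n)) f := by
  refine ⟨fun n => ?_, tendsto_sum_nat_add f⟩
  have := ((summable_nat_add_iff n).2 hf).sum_add_tsum_nat_add 1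
  simp only [Finset.range_one, Finset.sum_singleton, zero_add] at this
  simp only [← this, ← add_assoc, add_right_comm _ 1 n]
  abel

/-- A series whose terms are bounded by the decrements of a null sequence converges absolutely,
and its remainders are bounded by that sequence. -/
theorem IsTail.exists_of_norm_le {F f : ℕ → ℝ} (hF : IsTail F f) {g : ℕ → ℂ}
    (hg : ∀ n, ‖g n‖ ≤ f n) : ∃ G, IsTail G g ∧ ∀ n, ‖G n‖ ≤ F n := by
  have hf : Summable f := (summable_conditional_iff_of_nonneg
    fun n => (norm_nonneg _).trans (hg n)).1 (summable_conditional_iff.2 ⟨F, hF⟩)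
  have hgs : Summable g := hf.of_norm_bounded hg
  refine ⟨_, isTail_of_summable hgs, fun n => ?_⟩
  have h1 : F n = ∑' k, f (k + n) := by
    have h2 := ((summable_nat_add_iff n).2 hf).hasSum
    have h3 := hasSum_conditional_iff.1 (hF.hasSum n)
    simp only [add_comm n] at h3
    exact tendsto_nhds_unique h3 h2.tendsto_sum_nat
  rw [h1]
  exact tsum_of_norm_bounded ((summable_nat_add_iff n).2 hf).hasSum fun k => hg _

/-! ### Abel summation, and the equivalence of G and L -/

/-- Abel's summation: if `∑ ρ_n s_n` converges with `ρ` increasing to infinity, then `∑ s_n`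
converges, with remainders `o(1 / ρ_n)`. -/
theorem exists_tail_of_weighted {ρ : ℕ → ℝ} (hpos : ∀ n, 0 < ρ n) (hmono : StrictMono ρ)
    (hinf : Tendsto ρ atTop atTop) {s J : ℕ → ℂ} (hJ : IsTail J fun n => ρ n * s n) :
    ∃ S, IsTail S s ∧ Tendsto (fun n => ρ n * S n) atTop (𝓝 0) := by
  have hinv : Tendsto (fun n => (ρ n)⁻¹) atTop (𝓝 0) := tendsto_inv_atTop_zero.comp hinf
  have hinvle : ∀ n, 0 ≤ (ρ n)⁻¹ - (ρ (n + 1))⁻¹ := fun n =>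
    sub_nonneg.2 (inv_anti₀ (hpos n) (hmono n.lt_succ_self).le)
  obtain ⟨B, hB⟩ := (Metric.isBounded_range_of_tendsto _ hJ.2).exists_norm_le
  have hB' : ∀ n, ‖J n‖ ≤ B := fun n => hB _ ⟨n, rfl⟩
  have hnorm : ∀ n (a : ℝ), ‖J (n + 1)‖ ≤ a →
      ‖J (n + 1) * (((ρ n)⁻¹ - (ρ (n + 1))⁻¹ : ℝ) : ℂ)‖ ≤ a * ((ρ n)⁻¹ - (ρ (n + 1))⁻¹) := by
    intro n a ha
    rw [norm_mul, Complex.norm_real, Real.norm_of_nonneg (hinvle n)]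
    exact mul_le_mul_of_nonneg_right ha (hinvle n)
  have htailB : IsTail (fun n => B * (ρ n)⁻¹)
      (fun n => B * ((ρ n)⁻¹ - (ρ (n + 1))⁻¹)) :=
    ⟨fun n => by ring, by simpa using hinv.const_mul B⟩
  -- Summation by parts: S_n = J_n/ρ_n − G_n, where G is the tail of the absolutely convergent
  -- series of J_{k+1}(1/ρ_k − 1/ρ_{k+1}).
  obtain ⟨G, hG, -⟩ := htailB.exists_of_norm_le fun n => hnorm n B (hB' _)
  have hGo : Tendsto (fun n => ρ n * G n) atTop (𝓝 0) := by
    rw [Metric.tendsto_atTop]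
    intro ε hε
    -- Beyond N the bound B on J improves to ε/2, and 1/ρ telescopes, so |G_n| ≤ (ε/2)/ρ_n.
    obtain ⟨N, hN⟩ := Metric.tendsto_atTop.1 hJ.2 (ε / 2) (half_pos hε)
    have hs : IsTail (fun n => ε / 2 * (ρ (N + n))⁻¹)
        (fun n => ε / 2 * ((ρ (N + n))⁻¹ - (ρ (N + n + 1))⁻¹)) :=
      ⟨fun n => by simp only [← add_assoc]; ring, by
        have := ((tendsto_add_atTop_iff_nat N).2 hinv).const_mul (ε / 2)
        simpa [add_comm] using this⟩
    obtain ⟨G', hG', hb⟩ := hs.exists_of_norm_le fun n => hnorm (N + n) (ε / 2) (by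
      have := hN (N + n + 1) (by omega)
      rw [dist_zero_right] at this
      exact this.le)
    refine ⟨N, fun n hn => ?_⟩
    obtain ⟨m, rfl⟩ := Nat.exists_eq_add_of_le hn
    have heq : G' m = G (N + m) := by
      have h1 := hG'.hasSum m
      have h2 := hG.hasSum (N + m)
      simp only [add_assoc] at h1 h2
      exact h1.unique h2
    rw [dist_zero_right, norm_mul, Complex.norm_real, Real.norm_of_nonneg (hpos _).le, ← heq]
    calc ρ (N + m) * ‖G' m‖ ≤ ρ (N + m) * (ε / 2 * (ρ (N + m))⁻¹) :=
          mul_le_mul_of_nonneg_left (hb m) (hpos _).le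
      _ = ε / 2 := by have := (hpos (N + m)).ne'; field_simp
      _ < ε := half_lt_self hε
  have hρS : Tendsto (fun n => (ρ n : ℂ) * (J n / ρ n - G n)) atTop (𝓝 0) := by
    have := hJ.2.sub hGo
    rw [sub_zero] at this
    refine this.congr fun n => ?_
    have : (ρ n : ℂ) ≠ 0 := by exact_mod_cast (hpos n).ne'
    field_simp
  refine ⟨fun n => J n / ρ n - G n, ⟨fun n => ?_, ?_⟩, hρS⟩
  · have h1 : (ρ n : ℂ) ≠ 0 := by exact_mod_cast (hpos n).ne'
    have h2 : (ρ (n + 1) : ℂ) ≠ 0 := by exact_mod_cast (hpos (n + 1)).ne'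
    have e1 : J n - J (n + 1) = ρ n * s n := hJ.1 n
    have e2 := hG.1 n
    simp only at e2 ⊢
    have e3 : s n = (J n - J (n + 1)) / ρ n := by rw [e1]; field_simp
    have e4 : G n = G (n + 1) + J (n + 1) * (((ρ n)⁻¹ - (ρ (n + 1))⁻¹ : ℝ) : ℂ) := by
      rw [← e2]; ring
    rw [e4, e3]
    push_cast
    field_simp
    ring
  · have hinvC : Tendsto (fun n => ((ρ n)⁻¹ : ℂ)) atTop (𝓝 0) := by
      have := (Complex.continuous_ofReal.tendsto 0).comp hinv
      simpa [Function.comp_def] using this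
    have := hinvC.mul hρS
    rw [zero_mul] at this
    refine this.congr fun n => ?_
    have h1 : (ρ n : ℂ) ≠ 0 := by exact_mod_cast (hpos n).ne'
    rw [inv_mul_cancel_left₀ h1]

/-- For `J = C + D` with `D_n = ∑_{k ≥ n} δ_k C_{k+1}`, the series `∑ δ_n Re (J_{n+1} conj C_{n+1})`
converges if and only if `∑ δ_n |C_{n+1}|²` does. -/
theorem summable_re_mul_conj_iff {δ : ℕ → ℝ} (h0 : ∀ n, 0 ≤ δ n) (h1 : ∀ n, δ n ≤ 1)
    {J C : ℕ → ℂ} (hD : IsTail (fun n => J n - C n) fun n => δ n * C (n + 1)) :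
    Summable (fun n => (J (n + 1) * conj (C (n + 1))).re * δ n) (conditional ℕ) ↔
      Summable (fun n => ‖C (n + 1)‖ ^ 2 * δ n) := by
  have htel : Summable (fun n => (‖J n - C n‖ ^ 2 - ‖J (n + 1) - C (n + 1)‖ ^ 2) / 2)
      (conditional ℕ) := by
    refine summable_conditional_iff.2 ⟨fun n => ‖J n - C n‖ ^ 2 / 2, fun n => by ring, ?_⟩
    simpa using (hD.2.norm.pow 2).div_const 2
  -- Expand |D_n|² for D = J − C and D_n = D_{n+1} + δ_n C_{n+1}: the cross term is 2δ_n Re(D_{n+1}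
  -- conj C_{n+1}). The factor 1 − δ_n/2 lies in [1/2, 1] and does not affect convergence.
  have hid : ∀ n, (J (n + 1) * conj (C (n + 1))).re * δ n =
      ‖C (n + 1)‖ ^ 2 * δ n * (1 - δ n / 2) +
        (‖J n - C n‖ ^ 2 - ‖J (n + 1) - C (n + 1)‖ ^ 2) / 2 := by
    intro n
    have h := hD.1 n
    simp only at h
    rw [show J n - C n = J (n + 1) - C (n + 1) + δ n * C (n + 1) by rw [← h]; ring]
    simp only [← Complex.normSq_eq_norm_sq, Complex.normSq_apply, Complex.add_re, Complex.add_im,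
      Complex.sub_re, Complex.sub_im, Complex.mul_re, Complex.mul_im, Complex.conj_re,
      Complex.conj_im, Complex.ofReal_re, Complex.ofReal_im]
    ring
  have hnn : ∀ n, 0 ≤ ‖C (n + 1)‖ ^ 2 * δ n := fun n => mul_nonneg (sq_nonneg _) (h0 n)
  have hmid : Summable (fun n => (J (n + 1) * conj (C (n + 1))).re * δ n) (conditional ℕ) ↔
      Summable (fun n => ‖C (n + 1)‖ ^ 2 * δ n * (1 - δ n / 2)) := by
    rw [← summable_conditional_iff_of_nonneg fun n =>
      mul_nonneg (hnn n) (by linarith [h1 n])]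
    constructor
    · intro h
      refine (h.sub htel).congr fun n => ?_
      rw [hid]; ring
    · intro h
      refine (h.add htel).congr fun n => ?_
      rw [hid]
  rw [hmid]
  constructor
  · intro h
    refine (h.mul_left 2).of_nonneg_of_le hnn fun n => ?_
    nlinarith [hnn n, h1 n]
  · intro h
    refine h.of_nonneg_of_le (fun n => mul_nonneg (hnn n) (by linarith [h1 n])) fun n => ?_
    nlinarith [hnn n, h0 n]

/-! ### The first order system; necessity -/

/-- The first order system satisfied by `z = y / u` and `w = Δz / Δρ`, where `ρ = v / u`, when `y`
solves the perturbed equation. -/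
def IsSystem (ρ : ℕ → ℝ) (s z w : ℕ → ℂ) : Prop :=
  ∀ n, z (n + 1) - z n = ((ρ (n + 1) - ρ n : ℝ) : ℂ) * w n ∧ w (n + 1) - w n = s (n + 1) * z (n + 1)

/-- With t = (a − b)/b, all of a, b and 1 + t have positive real part, so log a − log b = log(1 + t)
without a branch jump, and log(1 + t) − t is quadratic in t. The constant 16 is generous. -/
theorem norm_log_sub_log_sub_le {a b : ℂ} (ha : ‖a - 1‖ ≤ 1 / 4) (hb : ‖b - 1‖ ≤ 1 / 4) :
    ‖Complex.log b - Complex.log a - (b - a) / b‖ ≤ 16 * ‖b - a‖ ^ 2 := by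
  have hre : ∀ x : ℂ, ‖x - 1‖ ≤ 1 / 4 → 3 / 4 ≤ x.re := by
    intro x hx
    have := (Complex.abs_re_le_norm (x - 1)).trans hx
    simp only [Complex.sub_re, Complex.one_re] at this
    linarith [(abs_le.1 this).1]
  have hra := hre a ha
  have hrb := hre b hb
  have hb0 : b ≠ 0 := by rintro rfl; simp at hrb; linarith
  have hnb : 3 / 4 ≤ ‖b‖ := hrb.trans (Complex.re_le_norm b)
  set t := (a - b) / b with ht
  have htb : 1 + t = a / b := by rw [ht]; field_simp; ring
  have hab : ‖a - b‖ ≤ 1 / 2 := by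
    calc ‖a - b‖ = ‖(a - 1) - (b - 1)‖ := by ring_nf
      _ ≤ _ := norm_sub_le _ _
      _ ≤ 1 / 2 := by linarith
  have htn : ‖t‖ ≤ 2 * ‖a - b‖ := by
    rw [ht, norm_div, div_le_iff₀ (by linarith)]
    nlinarith [norm_nonneg (a - b)]
  have htn' : ‖t‖ ≤ 2 / 3 := by
    rw [ht, norm_div, div_le_iff₀ (by linarith)]
    linarith
  have hlog : Complex.log a = Complex.log (1 + t) + Complex.log b := by
    have hrt : 0 < (1 + t).re := by
      have := (Complex.abs_re_le_norm t).trans htn'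
      simp only [Complex.add_re, Complex.one_re]
      linarith [(abs_le.1 this).1]
    have h1t : 1 + t ≠ 0 := by intro h; rw [h] at hrt; simp at hrt
    rw [← Complex.log_mul h1t hb0, htb, div_mul_cancel₀ _ hb0]
    have h1 := abs_lt.1 (Complex.abs_arg_lt_pi_div_two_iff.2 (Or.inl hrt))
    have h2 := abs_lt.1 (Complex.abs_arg_lt_pi_div_two_iff.2
      (Or.inl (show 0 < b.re by linarith)))
    exact ⟨by linarith [h1.1, h2.1], by linarith [h1.2, h2.2]⟩
  have h := Complex.norm_log_one_add_sub_self_le (z := t) (by linarith)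
  have hinv : (1 - ‖t‖)⁻¹ ≤ 3 := by
    rw [inv_le_comm₀ (by linarith) (by norm_num)]
    linarith
  calc ‖Complex.log b - Complex.log a - (b - a) / b‖ = ‖Complex.log (1 + t) - t‖ := by
        rw [hlog, ← norm_neg, ht]; congr 1; ring
    _ ≤ ‖t‖ ^ 2 * (1 - ‖t‖)⁻¹ / 2 := h
    _ ≤ ‖t‖ ^ 2 * 3 / 2 := by gcongr
    _ ≤ (2 * ‖a - b‖) ^ 2 * 3 / 2 := by gcongr
    _ ≤ 16 * ‖b - a‖ ^ 2 := by rw [norm_sub_rev a b]; nlinarith [sq_nonneg ‖b - a‖]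

/-- For a convergent sequence with square summable differences, the series of logarithmic
differences converges. -/
theorem summable_div_of_tendsto_one {z : ℕ → ℂ} (hz : Tendsto z atTop (𝓝 1))
    (hsq : Summable fun n => ‖z (n + 1) - z n‖ ^ 2) :
    Summable (fun n => (z (n + 1) - z n) / z (n + 1)) (conditional ℕ) := by
  have hlog : Tendsto (fun n => Complex.log (z n)) atTop (𝓝 0) := by
    have := (continuousAt_clog (x := 1) (by simp)).tendsto.comp hz
    simpa [Function.comp_def] using this
  have h1 : Summable (fun n => Complex.log (z (n + 1)) - Complex.log (z n)) (conditional ℕ) :=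
    summable_conditional_iff.2 ⟨fun n => -Complex.log (z n), fun n => by ring, by
      simpa using hlog.neg⟩
  have hev : ∀ᶠ n in atTop, ‖z n - 1‖ ≤ 1 / 4 := by
    have := Metric.tendsto_nhds.1 hz (1 / 4) (by norm_num)
    filter_upwards [this] with n hn
    rw [dist_eq_norm] at hn
    exact hn.le
  have h2 : Summable (fun n => Complex.log (z (n + 1)) - Complex.log (z n) -
      (z (n + 1) - z n) / z (n + 1)) := by
    refine Summable.of_norm_bounded_eventually_nat (hsq.mul_left 16) ?_
    filter_upwards [hev, (tendsto_add_atTop_nat 1).eventually hev] with n ha hb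
    exact norm_log_sub_log_sub_le ha hb
  have h3 := summable_conditional_iff.2 ⟨_, isTail_of_summable h2⟩
  exact (h1.sub h3).congr fun n => by ring

section

variable {ρ : ℕ → ℝ} {s z w : ℕ → ℂ}

/-- Necessity of the convergence of `J`. -/
theorem IsSystem.summable_weighted (hpos : ∀ n, 0 < ρ n) (hmono : StrictMono ρ)
    (h : IsSystem ρ s z w) (hz : Tendsto z atTop (𝓝 1))
    (hw : Tendsto (fun n => ρ n * w n) atTop (𝓝 0))
    (hsq : Summable fun n => (ρ (n + 1) - ρ n) * ρ (n + 1) * ‖w n‖ ^ 2) :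
    Summable (fun n => ρ n * s n) (conditional ℕ) := by
  have hΔ : ∀ n, 0 < ρ (n + 1) - ρ n := fun n => sub_pos.2 (hmono n.lt_succ_self)
  have hdz : ∀ n, ‖z (n + 1) - z n‖ = (ρ (n + 1) - ρ n) * ‖w n‖ := fun n => by
    rw [(h n).1, norm_mul, Complex.norm_real, Real.norm_of_nonneg (hΔ n).le]
  have h1 : Summable fun n => ‖z (n + 1) - z n‖ ^ 2 := by
    refine hsq.of_nonneg_of_le (fun n => sq_nonneg _) fun n => ?_
    rw [hdz, mul_pow, sq]
    have := hpos n
    have := hΔ n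
    gcongr
    linarith
  have h2 := summable_div_of_tendsto_one hz h1
  have h3 : Summable (fun n => ρ (n + 1) * w (n + 1) / z (n + 1) - ρ n * w n / z n)
      (conditional ℕ) := by
    refine summable_conditional_iff.2 ⟨fun n => -(ρ n * w n / z n), fun n => by ring, ?_⟩
    simpa using (hw.div hz one_ne_zero).neg
  have hzz : Tendsto (fun n => z n * z (n + 1)) atTop (𝓝 1) := by
    simpa using hz.mul ((tendsto_add_atTop_iff_nat 1).2 hz)
  have hev : ∀ᶠ n in atTop, 1 / 2 ≤ ‖z n * z (n + 1)‖ := by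
    have := hzz.norm
    rw [norm_one] at this
    exact this.eventually_const_le (by norm_num)
  have hz0 : ∀ᶠ n in atTop, z n ≠ 0 := hz.eventually_ne one_ne_zero
  have h4 : Summable (fun n => ρ n * w n * (z (n + 1) - z n) / (z n * z (n + 1))) := by
    refine Summable.of_norm_bounded_eventually_nat (hsq.mul_left 2) ?_
    filter_upwards [hev] with n hn
    rw [norm_div, norm_mul, norm_mul, Complex.norm_real, Real.norm_of_nonneg (hpos n).le, hdz,
      div_le_iff₀ (by linarith)]
    have e1 : ρ n * ‖w n‖ * ((ρ (n + 1) - ρ n) * ‖w n‖) ≤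
        (ρ (n + 1) - ρ n) * ρ (n + 1) * ‖w n‖ ^ 2 := by
      have := mul_le_mul_of_nonneg_right (hmono n.lt_succ_self).le
        (mul_nonneg (hΔ n).le (sq_nonneg ‖w n‖))
      linarith
    have e2 : 0 ≤ (ρ (n + 1) - ρ n) * ρ (n + 1) * ‖w n‖ ^ 2 :=
      mul_nonneg (mul_nonneg (hΔ n).le (hpos _).le) (sq_nonneg _)
    nlinarith
  have h4' := summable_conditional_iff.2 ⟨_, isTail_of_summable h4⟩
  -- The three series add up to ρ_{n+1}(w_{n+1} − w_n)/z_{n+1} = ρ_{n+1} s_{n+1}, because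
  -- Δz_n/z_{n+1} = Δρ_n w_n/z_{n+1}. This holds once z_n and z_{n+1} are nonzero.
  obtain ⟨F, hF⟩ := summable_conditional_iff.1 ((h3.sub h2).add h4')
  have hsum : ∀ᶠ n in atTop, F n - F (n + 1) = ρ (n + 1) * s (n + 1) := by
    filter_upwards [hz0, (tendsto_add_atTop_nat 1).eventually hz0] with n ha hb
    have e : s (n + 1) = (w (n + 1) - w n) / z (n + 1) := by
      rw [(h n).2, mul_div_cancel_right₀ _ hb]
    rw [hF.1, e]
    have e1 := (h n).1
    push_cast at e1
    field_simp
    linear_combination (-z n) * e1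
  obtain ⟨N, hN⟩ := eventually_atTop.1 hsum
  have hp : Tendsto (fun n => ∑ i ∈ Finset.range n, (ρ (N + 1 + i) : ℂ) * s (N + 1 + i)) atTop
      (𝓝 (F N)) := by
    refine (hasSum_conditional_iff (f := fun i => (ρ (N + 1 + i) : ℂ) * s (N + 1 + i))).1 ?_
    have : IsTail (fun n => F (N + n)) fun i => (ρ (N + 1 + i) : ℂ) * s (N + 1 + i) := by
      refine ⟨fun n => ?_, ?_⟩
      · have := hN (N + n) (by omega)
        simpa only [← add_assoc, add_right_comm N n 1] using this
      · simpa [add_comm] using (tendsto_add_atTop_iff_nat N).2 hF.2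
    simpa using this.hasSum 0
  refine ⟨(∑ i ∈ Finset.range (N + 1), (ρ i : ℂ) * s i) + F N, hasSum_conditional_iff.2 ?_⟩
  rw [← tendsto_add_atTop_iff_nat (N + 1)]
  refine (hp.const_add _).congr fun n => ?_
  rw [add_comm n, Finset.sum_range_add _ (N + 1) n]

/-- Necessity of the convergence of `G`. -/
theorem IsSystem.summable_sq_tail (hpos : ∀ n, 0 < ρ n) (hmono : StrictMono ρ)
    (h : IsSystem ρ s z w) (hz : Tendsto z atTop (𝓝 1))
    (hw : Tendsto (fun n => ρ n * w n) atTop (𝓝 0))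
    (hsq : Summable fun n => (ρ (n + 1) - ρ n) * ρ (n + 1) * ‖w n‖ ^ 2)
    {S : ℕ → ℂ} (hS : ∀ n, S n - S (n + 1) = s n)
    (hSo : Tendsto (fun n => ρ n * S n) atTop (𝓝 0)) :
    Summable fun n => (ρ (n + 1) - ρ n) * ρ (n + 1) * ‖S (n + 1)‖ ^ 2 := by
  have hΔ : ∀ n, 0 < ρ (n + 1) - ρ n := fun n => sub_pos.2 (hmono n.lt_succ_self)
  have hSo1 := (tendsto_add_atTop_iff_nat 1).2 hSo
  have hz1 := (tendsto_add_atTop_iff_nat 1).2 hz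
  -- If z were constant, w_n + S_{n+1} z_{n+1} would be constant; its actual increment is S_{n+2}
  -- Δz_{n+1}, a product of two small factors.
  set e : ℕ → ℂ := fun n => w n + S (n + 1) * z (n + 1) with he
  have hde : ∀ n, e (n + 1) - e n = S (n + 2) * ((ρ (n + 2) - ρ (n + 1) : ℝ) * w (n + 1)) := by
    intro n
    have h1 := (h n).2
    have h2 := (h (n + 1)).1
    have h3 := hS (n + 1)
    simp only [he, ← h2]
    linear_combination h1 - z (n + 1) * h3
  have hρe : Tendsto (fun n => ρ (n + 1) * e n) atTop (𝓝 0) := by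
    have h1 : Tendsto (fun n => ρ n * w n + (z (n + 1) - z n)) atTop (𝓝 0) := by
      simpa using hw.add (hz1.sub hz)
    have := h1.add (hSo1.mul hz1)
    rw [zero_mul, add_zero] at this
    refine this.congr fun n => ?_
    rw [(h n).1]
    simp only [he]
    push_cast
    ring
  have hev : ∀ᶠ n in atTop, ρ (n + 2) * ‖S (n + 2)‖ ≤ 1 / 4 := by
    have := ((tendsto_add_atTop_iff_nat 2).2 hSo).norm
    rw [norm_zero] at this
    filter_upwards [this.eventually_le_const (show (0 : ℝ) < 1 / 4 by norm_num)] with n hn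
    rwa [norm_mul, Complex.norm_real, Real.norm_of_nonneg (hpos _).le] at hn
  obtain ⟨N, hN⟩ := eventually_atTop.1 hev
  -- Hardy's inequality in differenced form. Since ρ|S| ≤ 1/4, passing from e_{n+1} to e_n costs at
  -- most Δρ_{n+1}|w_{n+1}|/4 after weighting by ρ_{n+1}. The growth of ρ² then leaves a multiple of
  -- ρ Δρ |e|², and the mixed term |e||w| is absorbed by the squares.
  have hstep : ∀ n ≥ N, (ρ (n + 2) - ρ (n + 1)) * ρ (n + 2) * ‖e (n + 1)‖ ^ 2 ≤
      2 * ((ρ (n + 2) * ‖e (n + 1)‖) ^ 2 - (ρ (n + 1) * ‖e n‖) ^ 2) +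
        (ρ (n + 2) - ρ (n + 1)) * ρ (n + 2) * ‖w (n + 1)‖ ^ 2 := by
    intro n hn
    have a1 := hpos (n + 1)
    have a2 := hΔ (n + 1)
    have a3 := hN n hn
    set p := ρ (n + 1)
    set p' := ρ (n + 2)
    set E := ‖e (n + 1)‖
    set W := ‖w (n + 1)‖
    have hp2 : 0 < p' - p := a2
    have hd : ‖e n‖ ≤ E + ‖S (n + 2)‖ * ((p' - p) * W) := by
      have : e n = e (n + 1) - S (n + 2) * ((p' - p : ℝ) * w (n + 1)) := by rw [← hde]; ring
      rw [this]
      refine (norm_sub_le _ _).trans ?_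
      rw [norm_mul, norm_mul, Complex.norm_real, Real.norm_of_nonneg hp2.le]
    have hpd : p * ‖e n‖ ≤ p * E + 1 / 4 * ((p' - p) * W) * (p / p') := by
      have hp'0 : 0 < p' := by linarith
      have hS4 : ‖S (n + 2)‖ ≤ 1 / 4 / p' := by
        rw [le_div_iff₀ hp'0]; linarith
      calc p * ‖e n‖ ≤ p * (E + 1 / 4 / p' * ((p' - p) * W)) := by
            refine mul_le_mul_of_nonneg_left (hd.trans ?_) a1.le
            gcongr
        _ = _ := by field_simp
    have hE0 : 0 ≤ E := norm_nonneg _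
    have hW0 : 0 ≤ W := norm_nonneg _
    have hpd' : p * ‖e n‖ ≤ p * E + 1 / 4 * ((p' - p) * W) := by
      refine hpd.trans ?_
      have : p / p' ≤ 1 := (div_le_one (by linarith)).2 (by linarith)
      have h0 : 0 ≤ 1 / 4 * ((p' - p) * W) := by positivity
      nlinarith
    have hsqle : (p * ‖e n‖) ^ 2 ≤ (p * E + 1 / 4 * ((p' - p) * W)) ^ 2 :=
      pow_le_pow_left₀ (by positivity) hpd' 2
    obtain ⟨d, hd'⟩ : ∃ d, d = p' - p := ⟨_, rfl⟩
    have hp'e : p' = p + d := by linarith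
    rw [← hd'] at hsqle hp2 ⊢
    rw [hp'e]
    nlinarith [mul_nonneg (mul_nonneg a1.le hp2.le) (sq_nonneg (E - W)),
      mul_nonneg (mul_nonneg a1.le hp2.le) (sq_nonneg E),
      mul_nonneg (mul_nonneg a1.le hp2.le) (sq_nonneg W), sq_nonneg (d * W), sq_nonneg (d * E)]
  have hsumE : Summable fun n => (ρ (n + 1) - ρ n) * ρ (n + 1) * ‖e n‖ ^ 2 := by
    rw [← summable_nat_add_iff (N + 1)]
    have htel : Summable (fun n => 2 * ((ρ (n + (N + 1) + 1) * ‖e (n + (N + 1))‖) ^ 2 -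
        (ρ (n + N + 1) * ‖e (n + N)‖) ^ 2)) (conditional ℕ) := by
      refine summable_conditional_iff.2
        ⟨fun n => -(2 * (ρ (n + N + 1) * ‖e (n + N)‖) ^ 2), fun n => ?_, ?_⟩
      · simp only [show n + 1 + N = n + (N + 1) by ring]
        ring
      · have := ((tendsto_add_atTop_iff_nat N).2 hρe).norm.pow 2
        simp only [norm_mul, Complex.norm_real, Real.norm_of_nonneg (hpos _).le, norm_zero] at this
        simpa using (this.const_mul 2).neg
    have hw' := (summable_conditional_iff_of_nonneg fun n => ?_).2
      ((summable_nat_add_iff (N + 1)).2 hsq)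
    · obtain ⟨a, ha⟩ := htel.add hw'
      rw [hasSum_conditional_iff] at ha
      obtain ⟨B, hB⟩ := ha.bddAbove_range
      refine summable_of_sum_range_le (c := B) (fun n => ?_) fun n => ?_
      · exact mul_nonneg (mul_nonneg (hΔ _).le (hpos _).le) (sq_nonneg _)
      · refine le_trans (Finset.sum_le_sum fun i _ => ?_) (hB ⟨n, rfl⟩)
        exact hstep (i + N) (by omega)
    · exact mul_nonneg (mul_nonneg (hΔ _).le (hpos _).le) (sq_nonneg _)
  have hz2 : ∀ᶠ n in atTop, 1 / 2 ≤ ‖z (n + 1)‖ := by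
    have := hz1.norm
    rw [norm_one] at this
    exact this.eventually_const_le (by norm_num)
  refine Summable.of_norm_bounded_eventually_nat ((hsumE.add hsq).mul_left 8) ?_
  filter_upwards [hz2] with n hn
  have h0 : 0 ≤ (ρ (n + 1) - ρ n) * ρ (n + 1) := mul_nonneg (hΔ _).le (hpos _).le
  rw [Real.norm_of_nonneg (mul_nonneg h0 (sq_nonneg _)), ← mul_add, mul_left_comm]
  refine mul_le_mul_of_nonneg_left ?_ h0
  have hb : ‖S (n + 1)‖ * ‖z (n + 1)‖ ≤ ‖e n‖ + ‖w n‖ := by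
    rw [← norm_mul, show S (n + 1) * z (n + 1) = e n - w n by simp [he]]
    exact norm_sub_le _ _
  have hb2 : ‖S (n + 1)‖ ≤ 2 * (‖e n‖ + ‖w n‖) := by
    nlinarith [norm_nonneg (S (n + 1))]
  nlinarith [norm_nonneg (S (n + 1)), sq_nonneg (‖e n‖ - ‖w n‖)]

end

/-! ### Conditionally convergent products and Stolz–Cesàro -/

/-- Factor 1 + c = e^c (1 + d) with d = O(|c|²). The exponentials telescope to e^{−D}, and the
product of 1 + d converges absolutely. -/
theorem exists_tendsto_one_of_isTail {c D : ℕ → ℂ} (hD : IsTail D c)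
    (hsq : Summable fun n => ‖c n‖ ^ 2) :
    ∃ P : ℕ → ℂ, Tendsto P atTop (𝓝 1) ∧ ∀ᶠ n in atTop, P (n + 1) = P n * (1 + c n) := by
  have hc : Tendsto c atTop (𝓝 0) := by
    have := hD.2.sub ((tendsto_add_atTop_iff_nat 1).2 hD.2)
    rw [sub_zero] at this
    exact this.congr hD.1
  set d : ℕ → ℂ := fun n => (1 + c n) * Complex.exp (-c n) - 1 with hd
  have hcn : ∀ᶠ n in atTop, ‖c n‖ ≤ 1 / 2 := by
    have := hc.norm
    rw [norm_zero] at this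
    exact this.eventually_le_const (by norm_num)
  have hds : Summable fun n => ‖d n‖ := by
    refine Summable.of_norm_bounded_eventually_nat (hsq.mul_left 3) ?_
    filter_upwards [hcn] with n hn
    have h1 := Complex.norm_exp_sub_one_sub_id_le (x := -c n) (by rw [norm_neg]; linarith)
    rw [norm_neg] at h1
    have h2 : d n = (1 + c n) * (Complex.exp (-c n) - 1 - -c n) - c n ^ 2 := by
      simp only [hd]; ring
    have h3 : ‖1 + c n‖ ≤ 2 := (norm_add_le _ _).trans (by rw [norm_one]; linarith)
    rw [norm_norm, h2]
    refine (norm_sub_le _ _).trans ?_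
    rw [norm_mul, norm_pow]
    nlinarith [norm_nonneg (Complex.exp (-c n) - 1 - -c n), sq_nonneg ‖c n‖]
  have hne : ∀ᶠ n in atTop, 1 + d n ≠ 0 := by
    have : Tendsto (fun n => 1 + c n) atTop (𝓝 1) := by simpa using hc.const_add 1
    filter_upwards [this.eventually_ne one_ne_zero] with n hn
    simp only [hd, add_sub_cancel]
    exact mul_ne_zero hn (Complex.exp_ne_zero _)
  obtain ⟨N, hN⟩ := eventually_atTop.1 hne
  have hds' : Summable fun k => ‖d (k + N)‖ := (summable_nat_add_iff N).2 hds
  have hL := tprod_one_add_ne_zero_of_summable (f := fun k => d (k + N))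
    (fun k => hN _ (by omega)) hds'
  have hlim := (multipliable_one_add_of_summable hds').hasProd.tendsto_prod_nat
  set L := ∏' k, (1 + d (k + N))
  -- Starting at N avoids vanishing factors, so L ≠ 0 and division by L makes the limit 1. For n < N
  -- the product is empty, and the recurrence is claimed only eventually.
  refine ⟨fun n => Complex.exp (-D n) * ((∏ k ∈ Finset.range (n - N), (1 + d (k + N))) / L),
    ?_, ?_⟩
  · have h1 : Tendsto (fun n => Complex.exp (-D n)) atTop (𝓝 1) := by
      have := (Complex.continuous_exp.tendsto _).comp hD.2.neg
      simpa [Function.comp_def] using this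
    have h2 := (hlim.comp (tendsto_sub_atTop_nat N)).div_const L
    rw [div_self hL] at h2
    simpa using h1.mul h2
  · filter_upwards [eventually_ge_atTop N] with n hn
    rw [show n + 1 - N = n - N + 1 by omega, Finset.prod_range_succ, Nat.sub_add_cancel hn,
      show -D (n + 1) = -D n + c n by rw [← hD.1]; ring, Complex.exp_add]
    simp only [hd, Complex.exp_neg]
    have := Complex.exp_ne_zero (c n)
    have := Complex.exp_ne_zero (D n)
    field_simp
    ring

/-- Stolz–Cesàro: the increments of f − lρ are o(Δρ), and since ρ → ∞ they sum to o(ρ). -/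
theorem tendsto_of_sub_eq {ρ : ℕ → ℝ} (hmono : StrictMono ρ) (hinf : Tendsto ρ atTop atTop)
    {f y : ℕ → ℂ} {l : ℂ} (hy : Tendsto y atTop (𝓝 l))
    (hf : ∀ᶠ n in atTop, f (n + 1) - f n = ((ρ (n + 1) - ρ n : ℝ) : ℂ) * y n) :
    Tendsto (fun n => f n / ρ n) atTop (𝓝 l) := by
  set ψ : ℕ → ℂ := fun n => f n - l * ρ n with hψ
  have hΔ : ∀ n, 0 < ρ (n + 1) - ρ n := fun n => sub_pos.2 (hmono n.lt_succ_self)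
  have h1 : (fun n => ψ (n + 1) - ψ n) =o[atTop] fun n => ρ (n + 1) - ρ n := by
    rw [isLittleO_iff]
    intro ε hε
    filter_upwards [hf, Metric.tendsto_nhds.1 hy ε hε] with n hn hyn
    have e : ψ (n + 1) - ψ n = ((ρ (n + 1) - ρ n : ℝ) : ℂ) * (y n - l) := by
      simp only [hψ]
      push_cast at hn ⊢
      linear_combination hn
    rw [e, norm_mul, Complex.norm_real, mul_comm]
    rw [dist_eq_norm] at hyn
    exact mul_le_mul_of_nonneg_right hyn.le (norm_nonneg _)
  have hto : Tendsto (fun n => ρ n - ρ 0) atTop atTop := by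
    simpa [sub_eq_add_neg] using tendsto_atTop_add_const_right atTop (-ρ 0) hinf
  have h2 := h1.sum_range (fun n => (hΔ n).le) (by simpa only [Finset.sum_range_sub] using hto)
  simp only [Finset.sum_range_sub] at h2
  have hconst : ∀ a : ℝ, (fun _ : ℕ => a) =o[atTop] ρ := fun a =>
    isLittleO_const_left.2 (Or.inr (tendsto_norm_atTop_atTop.comp hinf))
  have hconstC : (fun _ : ℕ => ψ 0) =o[atTop] ρ :=
    isLittleO_const_left.2 (Or.inr (tendsto_norm_atTop_atTop.comp hinf))
  have h3 : (fun n => ρ n - ρ 0) =O[atTop] ρ :=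
    (isBigO_refl ρ atTop).sub (hconst _).isBigO
  have h4 : ψ =o[atTop] ρ := by
    have := (h2.trans_isBigO h3).add hconstC
    simpa using this
  have h5 : ψ =o[atTop] fun n => (ρ n : ℂ) :=
    h4.trans_isBigO (IsBigO.of_bound 1 (Eventually.of_forall fun n => by simp))
  have h6 := h5.tendsto_div_nhds_zero.add_const l
  rw [zero_add] at h6
  refine h6.congr' ?_
  filter_upwards [hinf.eventually_gt_atTop 0] with n hn
  have : (ρ n : ℂ) ≠ 0 := by exact_mod_cast hn.ne'
  simp only [hψ]
  field_simp
  ring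

/-! ### Extending solutions and completing the recessive one -/

section

variable {ρ : ℕ → ℝ} {s z w : ℕ → ℂ}

/-- The system can be run backwards without any division: w_N is found from index N + 1, then z_N
from w_N. So a solution for large indices extends to all of ℕ. -/
theorem exists_isSystem_eventuallyEq
    (h : ∀ᶠ n in atTop, z (n + 1) - z n = ((ρ (n + 1) - ρ n : ℝ) : ℂ) * w n ∧
      w (n + 1) - w n = s (n + 1) * z (n + 1)) :
    ∃ z' w', IsSystem ρ s z' w' ∧ z' =ᶠ[atTop] z ∧ w' =ᶠ[atTop] w := by
  obtain ⟨N, hN⟩ := eventually_atTop.1 h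
  clear h
  induction N generalizing z w with
  | zero => exact ⟨z, w, fun n => hN n n.zero_le, .rfl, .rfl⟩
  | succ N ih =>
    set w₁ := Function.update w N (w (N + 1) - s (N + 1) * z (N + 1)) with hw₁
    set z₁ := Function.update z N (z (N + 1) - ((ρ (N + 1) - ρ N : ℝ) : ℂ) * w₁ N) with hz₁
    obtain ⟨z', w', h1, h2, h3⟩ := ih (z := z₁) (w := w₁) (fun n hn => by
      rcases hn.eq_or_lt with rfl | hlt
      · simp [hz₁, hw₁]
      · have a1 : n ≠ N := by omega
        have a2 : n + 1 ≠ N := by omega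
        simp only [hz₁, hw₁, Function.update_of_ne a1, Function.update_of_ne a2]
        exact hN n hlt)
    refine ⟨z', w', h1, h2.trans ?_, h3.trans ?_⟩
    · filter_upwards [eventually_gt_atTop N] with n hn
      rw [hz₁, Function.update_of_ne hn.ne']
    · filter_upwards [eventually_gt_atTop N] with n hn
      rw [hw₁, Function.update_of_ne hn.ne']

theorem exists_isSystem_of_initial (ρ : ℕ → ℝ) (s : ℕ → ℂ) (a b : ℂ) :
    ∃ z w, IsSystem ρ s z w ∧ z 0 = a ∧ w 0 = b := by
  let f : ℕ → ℂ × ℂ := fun n => Nat.rec (a, b) (fun n p =>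
    (p.1 + ((ρ (n + 1) - ρ n : ℝ) : ℂ) * p.2,
      p.2 + s (n + 1) * (p.1 + ((ρ (n + 1) - ρ n : ℝ) : ℂ) * p.2))) n
  refine ⟨fun n => (f n).1, fun n => (f n).2, fun n => ⟨?_, ?_⟩, rfl, rfl⟩
  · simp only [f]; ring
  · simp only [f]; ring

/-- One step of the system is a composition of two shears, hence has determinant 1. -/
theorem IsSystem.casoratian_eq {z₂ w₂ : ℕ → ℂ} (h : IsSystem ρ s z w) (h₂ : IsSystem ρ s z₂ w₂)
    (n : ℕ) : w₂ n * z n - w n * z₂ n = w₂ 0 * z 0 - w 0 * z₂ 0 := by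
  induction n with
  | zero => rfl
  | succ n ih =>
    obtain ⟨a1, a2⟩ := h n
    obtain ⟨b1, b2⟩ := h₂ n
    rw [← ih]
    linear_combination z (n + 1) * b2 - z₂ (n + 1) * a2 + w₂ n * a1 - w n * b1

/-- Reduction of order: the recessive solution is complemented by a dominant one. -/
theorem IsSystem.exists_dominant (hmono : StrictMono ρ) (hinf : Tendsto ρ atTop atTop)
    (h : IsSystem ρ s z w) (hz : Tendsto z atTop (𝓝 1))
    (hw : Tendsto (fun n => ρ n * w n) atTop (𝓝 0)) :
    ∃ z₂ w₂, IsSystem ρ s z₂ w₂ ∧ Tendsto (fun n => z₂ n / ρ n) atTop (𝓝 1) ∧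
      Tendsto w₂ atTop (𝓝 1) ∧ ∀ n, w₂ n * z n - w n * z₂ n = 1 := by
  -- Initial values making the Casoratian 1. They exist because (z_0, w_0) = (0, 0) would force z =
  -- 0 throughout, against z → 1.
  obtain ⟨a, b, hab⟩ : ∃ a b, b * z 0 - w 0 * a = 1 := by
    by_cases h0 : z 0 = 0
    · have hw0 : w 0 ≠ 0 := by
        intro hw0
        have : ∀ n, z n = 0 ∧ w n = 0 := by
          intro n
          induction n with
          | zero => exact ⟨h0, hw0⟩
          | succ n ih =>
            obtain ⟨a1, a2⟩ := h n
            rw [ih.1, ih.2] at a1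
            have hz1 : z (n + 1) = 0 := by simpa using a1
            rw [hz1, ih.2] at a2
            exact ⟨hz1, by simpa using a2⟩
        rw [show z = fun _ => 0 from funext fun n => (this n).1] at hz
        exact zero_ne_one (tendsto_nhds_unique tendsto_const_nhds hz)
      exact ⟨-(w 0)⁻¹, 0, by field_simp; ring⟩
    · exact ⟨0, (z 0)⁻¹, by field_simp; ring⟩
  obtain ⟨z₂, w₂, h₂, rfl, rfl⟩ := exists_isSystem_of_initial ρ s a b
  have hcas : ∀ n, w₂ n * z n - w n * z₂ n = 1 := fun n => (h.casoratian_eq h₂ n).trans hab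
  have hz1 := (tendsto_add_atTop_iff_nat 1).2 hz
  have hz0 : ∀ᶠ n in atTop, z n ≠ 0 := hz.eventually_ne one_ne_zero
  -- By the Casoratian, z₂/z has increments Δρ_n/(z_n z_{n+1}).
  have hquot : Tendsto (fun n => z₂ n / z n / ρ n) atTop (𝓝 1) := by
    have hy : Tendsto (fun n => 1 / (z n * z (n + 1))) atTop (𝓝 1) := by
      have := (hz.mul hz1).inv₀ (by simp)
      simpa using this
    refine tendsto_of_sub_eq hmono hinf hy ?_
    filter_upwards [hz0, (tendsto_add_atTop_nat 1).eventually hz0] with n a b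
    have a1 := (h n).1
    have b1 := (h₂ n).1
    have c1 := hcas n
    field_simp
    linear_combination ((ρ (n + 1) - ρ n : ℝ) : ℂ) * c1 + z n * b1 - z₂ n * a1
  have hz₂ : Tendsto (fun n => z₂ n / ρ n) atTop (𝓝 1) := by
    have := hquot.mul hz
    rw [one_mul] at this
    refine this.congr' ?_
    filter_upwards [hz0] with n a
    field_simp
  refine ⟨z₂, w₂, h₂, hz₂, ?_, hcas⟩
  -- The Casoratian gives w₂ = (1 + w z₂)/z, and w z₂ = (ρw)(z₂/ρ) → 0.
  have h3 : Tendsto (fun n => (1 + ρ n * w n * (z₂ n / ρ n)) / z n) atTop (𝓝 1) := by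
    have := ((hw.mul hz₂).const_add 1).div hz one_ne_zero
    rw [zero_mul, add_zero, div_one] at this
    exact this
  refine h3.congr' ?_
  filter_upwards [hz0, hinf.eventually_gt_atTop 0] with n a b
  have b' : (ρ n : ℂ) ≠ 0 := by exact_mod_cast b.ne'
  have c1 := hcas n
  field_simp
  linear_combination -c1

end

/-! ### Sufficiency: construction of the recessive solution -/

theorem norm_sum_Ico_le {ρ : ℕ → ℝ} (hpos : ∀ n, 0 < ρ n) {a : ℕ → ℂ}
    {K : ℝ} (hK : 0 ≤ K) (ha : ∀ n, ‖a n‖ ≤ K * (ρ (n + 1) - ρ n)) (n j : ℕ) :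
    ‖∑ k ∈ Finset.Ico n j, a k‖ ≤ K * ρ j := by
  rcases le_total j n with h | h
  · rw [Finset.Ico_eq_empty_of_le h, Finset.sum_empty, norm_zero]
    exact mul_nonneg hK (hpos j).le
  · refine (norm_sum_le_of_le _ fun k _ => ha k).trans ?_
    rw [← Finset.mul_sum, Finset.sum_Ico_sub (fun k => ρ k) h]
    exact mul_le_mul_of_nonneg_left (by linarith [hpos n]) hK

/-- Solution of a summation equation with small coefficients, by the contraction principle. -/
theorem exists_bounded_solution {A : ℕ → ℕ → ℂ} {β : ℕ → ℝ} (hA : ∀ n j, ‖A n j‖ ≤ β j)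
    (hβ : Summable β) (hsmall : ∑' j, β j ≤ 1 / 2) :
    ∃ (x : ℕ → ℂ) (B : ℝ), (∀ n, ‖x n‖ ≤ B) ∧ ∀ n, x n = 1 - ∑' j, A n j * x (j + 1) := by
  have hterm : ∀ (x : BoundedContinuousFunction ℕ ℂ) n j,
      ‖A n j * x (j + 1)‖ ≤ β j * ‖x‖ := fun x n j => by
    rw [norm_mul]
    exact mul_le_mul (hA n j) (x.norm_coe_le_norm _) (norm_nonneg _)
      ((norm_nonneg _).trans (hA n j))
  have hsum : ∀ (x : BoundedContinuousFunction ℕ ℂ) n, Summable fun j => A n j * x (j + 1) :=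
    fun x n => (hβ.mul_right _).of_norm_bounded (hterm x n)
  have hnorm : ∀ (x : BoundedContinuousFunction ℕ ℂ) n,
      ‖∑' j, A n j * x (j + 1)‖ ≤ 1 / 2 * ‖x‖ := fun x n => by
    refine (tsum_of_norm_bounded (hβ.mul_right ‖x‖).hasSum (hterm x n)).trans ?_
    rw [tsum_mul_right]
    exact mul_le_mul_of_nonneg_right hsmall (norm_nonneg _)
  let T : BoundedContinuousFunction ℕ ℂ → BoundedContinuousFunction ℕ ℂ := fun x =>
    BoundedContinuousFunction.ofNormedAddCommGroupDiscrete
      (fun n => 1 - ∑' j, A n j * x (j + 1)) (1 + 1 / 2 * ‖x‖)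
      fun n => (norm_sub_le _ _).trans (by rw [norm_one]; linarith [hnorm x n])
  have hT : ∀ x n, T x n = 1 - ∑' j, A n j * x (j + 1) := fun x n => rfl
  have hcontr : ContractingWith (1 / 2) T := by
    refine ⟨by norm_num, LipschitzWith.of_dist_le_mul fun x y => ?_⟩
    rw [BoundedContinuousFunction.dist_le (by positivity)]
    intro n
    have e : T x n - T y n = -∑' j, A n j * (x - y) (j + 1) := by
      rw [hT, hT, sub_sub_sub_cancel_left, ← neg_sub, ← (hsum x n).tsum_sub (hsum y n)]
      simp only [BoundedContinuousFunction.coe_sub, Pi.sub_apply, mul_sub]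
    rw [dist_eq_norm, e, norm_neg, dist_eq_norm]
    simpa using hnorm (x - y) n
  have hfix := hcontr.fixedPoint_isFixedPt
  set x := ContractingWith.fixedPoint T hcontr
  exact ⟨x, ‖x‖, fun n => x.norm_coe_le_norm n, fun n => by
    conv_lhs => rw [← hfix]
    exact hT x n⟩

/-- The system `Δx_n = a_n E_n`, `ΔE_{n-1} = -b_n x_{n+1}` with absolutely summable perturbation
has a solution with `x → 1` and `E` small. -/
theorem exists_solution_of_summable {ρ : ℕ → ℝ} (hpos : ∀ n, 0 < ρ n) (hmono : StrictMono ρ)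
    {a b : ℕ → ℂ} {K : ℝ} (hK : 0 ≤ K) (ha : ∀ n, ‖a n‖ ≤ K * (ρ (n + 1) - ρ n))
    (hb : Summable fun n => ρ n * ‖b n‖) :
    ∃ x E : ℕ → ℂ, ∃ B : ℝ, Tendsto x atTop (𝓝 1) ∧ (∀ n, x (n + 1) - x n = a n * E n) ∧
      (∀ᶠ n in atTop, E n - E (n + 1) = b (n + 1) * x (n + 2)) ∧ 0 ≤ B ∧
      ∀ n, ‖E n‖ ≤ B * ∑' k, ‖b (k + (n + 1))‖ := by
  have htail := isTail_of_summable hb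
  obtain ⟨N, hN⟩ : ∃ N, K * ∑' k, ρ (k + N) * ‖b (k + N)‖ ≤ 1 / 2 := by
    have h := htail.2.const_mul K
    rw [mul_zero] at h
    obtain ⟨N, hN⟩ := (h.eventually_le_const (show (0 : ℝ) < 1 / 2 by norm_num)).exists
    exact ⟨N, hN⟩
  -- Dropping the coefficients below N brings the total mass of the kernel down to 1/2; the price is
  -- that the equation for E holds only eventually.
  set b' : ℕ → ℂ := fun n => if N ≤ n then b n else 0 with hb'
  have hb'le : ∀ n, ‖b' n‖ ≤ ‖b n‖ := fun n => by
    simp only [hb']; split_ifs <;> simp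
  have hb's : Summable fun n => ρ n * ‖b' n‖ := hb.of_nonneg_of_le
    (fun n => mul_nonneg (hpos n).le (norm_nonneg _))
    fun n => mul_le_mul_of_nonneg_left (hb'le n) (hpos n).le
  have hbn : Summable fun n => ‖b n‖ := by
    refine (hb.mul_left (ρ 0)⁻¹).of_nonneg_of_le (fun n => norm_nonneg _) fun n => ?_
    rw [inv_mul_eq_div, le_div_iff₀ (hpos 0), mul_comm]
    exact mul_le_mul_of_nonneg_right (hmono.monotone n.zero_le) (norm_nonneg _)
  have hβ : Summable fun n => K * ρ n * ‖b' n‖ :=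
    (hb's.mul_left K).congr fun n => by ring
  have hβsum : ∑' n, K * ρ n * ‖b' n‖ ≤ 1 / 2 := by
    refine le_of_eq_of_le ?_ hN
    rw [← hβ.sum_add_tsum_nat_add N, Finset.sum_eq_zero, zero_add, ← tsum_mul_left]
    · refine tsum_congr fun k => ?_
      simp [hb', mul_assoc]
    · intro k hk
      simp [hb', Nat.not_le.2 (Finset.mem_range.1 hk)]
  -- Insert E_k = ∑_{j>k} b'_j x_{j+1} into x_n = 1 − ∑_{k≥n} a_k E_k and exchange the sums: the
  -- kernel is (∑_{n≤k<j} a_k) b'_j.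
  have hA : ∀ n j, ‖(∑ k ∈ Finset.Ico n j, a k) * b' j‖ ≤ K * ρ j * ‖b' j‖ := fun n j => by
    rw [norm_mul]
    exact mul_le_mul_of_nonneg_right (norm_sum_Ico_le hpos hK ha n j) (norm_nonneg _)
  obtain ⟨x, B, hB, hx⟩ := exists_bounded_solution hA hβ hβsum
  have hB0 : 0 ≤ B := (norm_nonneg _).trans (hB 0)
  have hs : ∀ n, Summable fun j => (∑ k ∈ Finset.Ico n j, a k) * b' j * x (j + 1) := fun n =>
    (hβ.mul_right B).of_norm_bounded fun j => by
      rw [norm_mul]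
      exact mul_le_mul (hA n j) (hB _) (norm_nonneg _) ((norm_nonneg _).trans (hA n j))
  have hbx : Summable fun j => b' j * x (j + 1) :=
    (hbn.mul_right B).of_norm_bounded fun j => by
      rw [norm_mul]
      exact mul_le_mul (hb'le j) (hB _) (norm_nonneg _) (norm_nonneg _)
  have hE := isTail_of_summable hbx
  refine ⟨x, fun n => ∑' k, b' (k + (n + 1)) * x (k + (n + 1) + 1), B, ?_, ?_, ?_, hB0, ?_⟩
  -- Dominated convergence: for fixed j the inner sum is empty once n ≥ j.
  · have h0 : Tendsto (fun n => ∑' j, (∑ k ∈ Finset.Ico n j, a k) * b' j * x (j + 1)) atTop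
        (𝓝 (∑' _ : ℕ, (0 : ℂ))) := by
      refine tendsto_tsum_of_dominated_convergence (hβ.mul_right B) (fun j => ?_)
        (Eventually.of_forall fun n j => ?_)
      · refine tendsto_const_nhds.congr' ?_
        filter_upwards [eventually_ge_atTop j] with n hn
        simp [Finset.Ico_eq_empty_of_le hn]
      · rw [norm_mul]
        exact mul_le_mul (hA n j) (hB _) (norm_nonneg _) ((norm_nonneg _).trans (hA n j))
    have h1 := h0.const_sub 1
    rw [tsum_zero, sub_zero] at h1
    exact h1.congr fun n => (hx n).symm
  · intro n
    beta_reduce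
    have h1 : ∀ j, (∑ k ∈ Finset.Ico n j, a k) * b' j * x (j + 1) -
        (∑ k ∈ Finset.Ico (n + 1) j, a k) * b' j * x (j + 1) =
          a n * (if n < j then b' j * x (j + 1) else 0) := by
      intro j
      split_ifs with h
      · rw [Finset.sum_eq_sum_Ico_succ_bot h]; ring
      · rw [Finset.Ico_eq_empty_of_le (by omega), Finset.Ico_eq_empty_of_le (by omega)]; simp
    have hif : Summable fun j => if n < j then b' j * x (j + 1) else 0 := by
      refine hbx.norm.of_norm_bounded fun j => ?_
      split_ifs
      · exact le_rfl
      · simpa using mul_nonneg (norm_nonneg (b' j)) (norm_nonneg (x (j + 1)))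
    have h2 : ∑' j, (if n < j then b' j * x (j + 1) else 0) =
        ∑' k, b' (k + (n + 1)) * x (k + (n + 1) + 1) := by
      rw [← hif.sum_add_tsum_nat_add (n + 1), Finset.sum_eq_zero, zero_add]
      · refine tsum_congr fun k => if_pos (by omega)
      · intro k hk
        rw [if_neg]
        have := Finset.mem_range.1 hk
        omega
    rw [hx n, hx (n + 1), sub_sub_sub_cancel_left, ← (hs n).tsum_sub (hs (n + 1)), ← h2,
      ← tsum_mul_left]
    exact tsum_congr h1
  · filter_upwards [eventually_ge_atTop N] with n hn
    have := hE.1 (n + 1)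
    simp only at this ⊢
    rw [this]
    simp [hb', show N ≤ n + 1 by omega]
  · intro n
    rw [← tsum_mul_left]
    refine tsum_of_norm_bounded (((summable_nat_add_iff (n + 1)).2 hbn).mul_left B).hasSum
      fun k => ?_
    rw [norm_mul, mul_comm]
    exact mul_le_mul (hB _) (hb'le _) (norm_nonneg _) hB0

/-- A discrete Hardy inequality for the remainders `F_n = ∑_{k > n} g_k / ρ_{k+1}`. -/
theorem hardy_tail {ρ : ℕ → ℝ} (hpos : ∀ n, 0 < ρ n) (hmono : StrictMono ρ)
    {g : ℕ → ℝ} (hg0 : ∀ n, 0 ≤ g n) (hg : Summable g) :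
    Summable (fun n => (ρ (n + 1) - ρ n) * ∑' k, g (k + (n + 1)) / ρ (k + (n + 1) + 1)) ∧
      Tendsto (fun n => ρ (n + 1) * ∑' k, g (k + (n + 1)) / ρ (k + (n + 1) + 1)) atTop (𝓝 0) := by
  have hh : Summable fun n => g n / ρ (n + 1) := by
    refine (hg.div_const (ρ 0)).of_nonneg_of_le (fun n => div_nonneg (hg0 n) (hpos _).le)
      fun n => ?_
    exact div_le_div_of_nonneg_left (hg0 n) (hpos 0) (hmono.monotone (Nat.zero_le _))
  have htail := isTail_of_summable hh
  set F : ℕ → ℝ := fun n => ∑' k, g (k + (n + 1)) / ρ (k + (n + 1) + 1) with hF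
  have hF0 : ∀ n, 0 ≤ F n := fun n => tsum_nonneg fun k => div_nonneg (hg0 _) (hpos _).le
  have hFle : ∀ n, ρ (n + 1) * F n ≤ ∑' k, g (k + (n + 1)) := by
    intro n
    simp only [hF]
    rw [← tsum_mul_left]
    refine Summable.tsum_le_tsum (fun k => ?_)
      (((summable_nat_add_iff (n + 1)).2 hh).mul_left _) ((summable_nat_add_iff (n + 1)).2 hg)
    rw [mul_div_left_comm]
    refine mul_le_of_le_one_right (hg0 _) ((div_le_one (hpos _)).2 (hmono.monotone (by omega)))
  have hFstep : ∀ n, F n - F (n + 1) = g (n + 1) / ρ (n + 2) := fun n => htail.1 (n + 1)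
  have hgt : ∀ n, ∑' k, g (k + n) ≤ ∑' k, g k := fun n => by
    rw [← hg.sum_add_tsum_nat_add n]
    exact le_add_of_nonneg_left (Finset.sum_nonneg fun i _ => hg0 i)
  constructor
  -- Summation by parts leaves ρ_M F_M and the terms ρ_{n+1}(F_n − F_{n+1}) = ρ_{n+1}
  -- g_{n+1}/ρ_{n+2} ≤ g_{n+1}.
  · have hpart : ∀ M, ∑ n ∈ Finset.range M, (ρ (n + 1) - ρ n) * F n ≤
        ρ M * F M + ∑ n ∈ Finset.range M, g (n + 1) := by
      intro M
      induction M with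
      | zero => simpa using mul_nonneg (hpos 0).le (hF0 0)
      | succ M ih =>
        rw [Finset.sum_range_succ, Finset.sum_range_succ]
        have h1 : ρ (M + 1) * F M ≤ ρ (M + 1) * F (M + 1) + g (M + 1) := by
          have : ρ (M + 1) * (g (M + 1) / ρ (M + 2)) ≤ g (M + 1) := by
            rw [mul_div_left_comm]
            exact mul_le_of_le_one_right (hg0 _)
              ((div_le_one (hpos _)).2 (hmono.monotone (by omega)))
          rw [← hFstep] at this
          linarith
        linarith
    refine summable_of_sum_range_le (c := (∑' k, g k) + ∑' k, g k)
      (fun n => mul_nonneg (sub_nonneg.2 (hmono n.lt_succ_self).le) (hF0 n)) fun M => ?_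
    refine (hpart M).trans (add_le_add ?_ ?_)
    · refine (mul_le_mul_of_nonneg_right (hmono.monotone M.le_succ) (hF0 M)).trans
        ((hFle M).trans (hgt _))
    · exact (((summable_nat_add_iff 1).2 hg).sum_le_tsum _ fun i _ => hg0 _).trans (hgt 1)
  · exact squeeze_zero (fun n => mul_nonneg (hpos _).le (hF0 n)) hFle
      ((tendsto_add_atTop_iff_nat 1).2 (isTail_of_summable hg).2)

theorem exists_norm_le_of_tendsto {f : ℕ → ℂ} {l : ℂ} (hf : Tendsto f atTop (𝓝 l)) :
    ∃ K, 0 ≤ K ∧ ∀ n, ‖f n‖ ≤ K := by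
  obtain ⟨K, hK⟩ := (Metric.isBounded_range_of_tendsto _ hf).exists_norm_le
  exact ⟨K, (norm_nonneg _).trans (hK _ ⟨0, rfl⟩), fun n => hK _ ⟨n, rfl⟩⟩

/-- Sufficiency: a recessive solution with `z → 1` and `ρ w → 0`. -/
theorem exists_recessive {ρ : ℕ → ℝ} (hpos : ∀ n, 0 < ρ n) (hmono : StrictMono ρ)
    {s S D : ℕ → ℂ} (hS : ∀ n, S n - S (n + 1) = s n)
    (hSo : Tendsto (fun n => ρ n * S n) atTop (𝓝 0))
    (hD : IsTail D fun n => ((ρ (n + 1) - ρ n : ℝ) : ℂ) * S (n + 1))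
    (hsq : Summable fun n => (ρ (n + 1) - ρ n) * ρ (n + 1) * ‖S (n + 1)‖ ^ 2) :
    ∃ z w, IsSystem ρ s z w ∧ Tendsto z atTop (𝓝 1) ∧
      Tendsto (fun n => ρ n * w n) atTop (𝓝 0) ∧
      Summable fun n => (ρ (n + 1) - ρ n) * ρ (n + 1) * ‖w n‖ ^ 2 := by
  have hΔ : ∀ n, 0 < ρ (n + 1) - ρ n := fun n => sub_pos.2 (hmono n.lt_succ_self)
  set c : ℕ → ℂ := fun n => ((ρ (n + 1) - ρ n : ℝ) : ℂ) * S (n + 1) with hc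
  have hcn : ∀ n, ‖c n‖ = (ρ (n + 1) - ρ n) * ‖S (n + 1)‖ := fun n => by
    rw [hc, norm_mul, Complex.norm_real, Real.norm_of_nonneg (hΔ n).le]
  have hcsq : Summable fun n => ‖c n‖ ^ 2 := by
    refine hsq.of_nonneg_of_le (fun n => sq_nonneg _) fun n => ?_
    rw [hcn, mul_pow, sq]
    have := hpos n
    have := hΔ n
    gcongr
    linarith
  -- Writing w_n = e_n − S_{n+1} z_{n+1}, the system reads (1 + c_n) z_{n+1} = z_n + Δρ_n e_n and
  -- e_n = (1 − c_{n+1}) e_{n+1} + S_{n+2} c_{n+1} z_{n+2}. The integrating factors P and Q remove 1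
  -- + c and 1 − c: x_n = P_n z_n and E_n = Q_{n+1} e_n satisfy a system with coefficients a and b
  -- only.
  obtain ⟨P, hP1, hP⟩ := exists_tendsto_one_of_isTail hD hcsq
  obtain ⟨Q, hQ1, hQ⟩ := exists_tendsto_one_of_isTail (c := fun n => -c n) (D := fun n => -D n)
    ⟨fun n => by have := hD.1 n; beta_reduce; rw [← this]; ring, by simpa using hD.2.neg⟩ (by simpa using hcsq)
  have hP1' := (tendsto_add_atTop_iff_nat 1).2 hP1
  have hQ1' := (tendsto_add_atTop_iff_nat 1).2 hQ1
  obtain ⟨K, hK0, hK⟩ := exists_norm_le_of_tendsto (hP1.mul (hQ1'.inv₀ one_ne_zero))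
  obtain ⟨M, hM0, hM⟩ := exists_norm_le_of_tendsto (hQ1.mul (hP1'.inv₀ one_ne_zero))
  set a : ℕ → ℂ := fun n => P n * (Q (n + 1))⁻¹ * ((ρ (n + 1) - ρ n : ℝ) : ℂ) with ha
  set b : ℕ → ℂ := fun n => Q n * (P (n + 1))⁻¹ * (S (n + 1) * c n) with hb
  set g : ℕ → ℝ := fun n => (ρ (n + 1) - ρ n) * ρ (n + 1) * ‖S (n + 1)‖ ^ 2 with hg
  have hg0 : ∀ n, 0 ≤ g n := fun n => mul_nonneg (mul_nonneg (hΔ n).le (hpos _).le) (sq_nonneg _)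
  have han : ∀ n, ‖a n‖ ≤ K * (ρ (n + 1) - ρ n) := fun n => by
    rw [ha, norm_mul, Complex.norm_real, Real.norm_of_nonneg (hΔ n).le]
    exact mul_le_mul_of_nonneg_right (hK n) (hΔ n).le
  -- Here |S_{n+1} c_n| = Δρ_n |S_{n+1}|² = g_n/ρ_{n+1}, so convergence of ∑ g makes ρ|b| summable.
  have hbn : ∀ n, ‖b n‖ ≤ M * (g n / ρ (n + 1)) := fun n => by
    rw [hb, norm_mul]
    refine mul_le_mul (hM n) (le_of_eq ?_) (norm_nonneg _) hM0
    rw [norm_mul, hcn, hg]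
    have := (hpos (n + 1)).ne'
    field_simp
  have hbs : Summable fun n => ρ n * ‖b n‖ := by
    refine (hsq.mul_left M).of_nonneg_of_le (fun n => mul_nonneg (hpos n).le (norm_nonneg _))
      fun n => (mul_le_mul_of_nonneg_left (hbn n) (hpos n).le).trans ?_
    rw [mul_left_comm, mul_div_left_comm]
    exact mul_le_mul_of_nonneg_left (mul_le_of_le_one_right (hg0 n)
      ((div_le_one (hpos _)).2 (hmono n.lt_succ_self).le)) hM0
  obtain ⟨x, E, B, hx1, hxa, hEb, hB0, hEB⟩ :=
    exists_solution_of_summable hpos hmono hK0 han hbs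
  obtain ⟨hF1, hF2⟩ := hardy_tail hpos hmono hg0 hsq
  set F : ℕ → ℝ := fun n => ∑' k, g (k + (n + 1)) / ρ (k + (n + 1) + 1) with hF
  have hh : Summable fun n => g n / ρ (n + 1) := by
    refine (hsq.div_const (ρ 0)).of_nonneg_of_le (fun n => div_nonneg (hg0 n) (hpos _).le)
      fun n => ?_
    exact div_le_div_of_nonneg_left (hg0 n) (hpos 0) (hmono.monotone (Nat.zero_le _))
  have hEF : ∀ n, ‖E n‖ ≤ B * M * F n := fun n => by
    refine (hEB n).trans ?_
    rw [mul_assoc]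
    refine mul_le_mul_of_nonneg_left ?_ hB0
    rw [hF, ← tsum_mul_left]
    have hr := ((summable_nat_add_iff (n + 1)).2 hh).mul_left M
    exact Summable.tsum_le_tsum (fun k => hbn _)
      (hr.of_nonneg_of_le (fun k => norm_nonneg _) fun k => hbn _) hr
  obtain ⟨R, hR0, hR⟩ := exists_norm_le_of_tendsto (hQ1'.inv₀ one_ne_zero)
  set z : ℕ → ℂ := fun n => x n * (P n)⁻¹ with hz
  set e : ℕ → ℂ := fun n => E n * (Q (n + 1))⁻¹ with he
  set w : ℕ → ℂ := fun n => e n - S (n + 1) * z (n + 1) with hw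
  have hz1 : Tendsto z atTop (𝓝 1) := by simpa using hx1.mul (hP1.inv₀ one_ne_zero)
  have hz1' := (tendsto_add_atTop_iff_nat 1).2 hz1
  have hen : ∀ n, ‖e n‖ ≤ R * (B * M) * F n := fun n => by
    rw [he, norm_mul, mul_comm, mul_assoc]
    exact mul_le_mul (hR n) (hEF n) (norm_nonneg _) hR0
  have hP0 : ∀ᶠ n in atTop, P n ≠ 0 := hP1.eventually_ne one_ne_zero
  have hQ0 : ∀ᶠ n in atTop, Q n ≠ 0 := hQ1.eventually_ne one_ne_zero
  have sh : ∀ {p : ℕ → Prop}, (∀ᶠ n in atTop, p n) → ∀ᶠ n in atTop, p (n + 1) := fun h =>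
    (tendsto_add_atTop_nat 1).eventually h
  have hsys1 : ∀ᶠ n in atTop, z (n + 1) - z n = ((ρ (n + 1) - ρ n : ℝ) : ℂ) * w n := by
    filter_upwards [hP0, sh hP0, sh hQ0, hP] with n p0 p1 q1 hPn
    have h1 := hxa n
    have h2 : 1 + c n ≠ 0 := by
      intro h; rw [h, mul_zero] at hPn; exact p1 hPn
    have h3 : x (n + 1) = x n + a n * E n := by rw [← h1]; ring
    have h4 : z (n + 1) * (1 + c n) = z n + ((ρ (n + 1) - ρ n : ℝ) : ℂ) * e n := by
      simp only [hz, he, h3, hPn, ha]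
      field_simp
    have h5 : c n = ((ρ (n + 1) - ρ n : ℝ) : ℂ) * S (n + 1) := rfl
    rw [h5] at h4
    simp only [hw]
    linear_combination h4
  have hsys2 : ∀ᶠ n in atTop, w (n + 1) - w n = s (n + 1) * z (n + 1) := by
    filter_upwards [sh hsys1, sh hQ0, sh (sh hQ0), sh (sh hP0), sh hQ, hEb] with
      n h1 q1 q2 p2 hQn hE
    have h2 : 1 + -c (n + 1) ≠ 0 := by
      intro h; rw [h, mul_zero] at hQn; exact q2 hQn
    have h3 : E n = E (n + 1) + b (n + 1) * x (n + 2) := by rw [← hE]; ring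
    have h4 : e n = (1 + -c (n + 1)) * e (n + 1) + S (n + 2) * c (n + 1) * z (n + 2) := by
      simp only [he, h3, hz, hb, hQn]
      field_simp
    have h5 : c (n + 1) = ((ρ (n + 2) - ρ (n + 1) : ℝ) : ℂ) * S (n + 2) := rfl
    have h6 : w (n + 1) = e (n + 1) - S (n + 2) * z (n + 2) := rfl
    have h7 : w n = e n - S (n + 1) * z (n + 1) := rfl
    rw [h5] at h4
    have h8 := hS (n + 1)
    rw [h6] at h1
    rw [h6, h7, h4]
    linear_combination (-S (n + 2)) * h1 + z (n + 1) * h8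
  obtain ⟨z', w', hsys, hzz, hww⟩ := exists_isSystem_eventuallyEq (hsys1.and hsys2)
  have hρe : Tendsto (fun n => ρ (n + 1) * e n) atTop (𝓝 0) := by
    have h := hF2.const_mul (R * (B * M))
    rw [mul_zero] at h
    refine squeeze_zero_norm (fun n => ?_) h
    rw [norm_mul, Complex.norm_real, Real.norm_of_nonneg (hpos _).le]
    have := mul_le_mul_of_nonneg_left (hen n) (hpos (n + 1)).le
    linarith
  have hρw : Tendsto (fun n => ρ (n + 1) * w n) atTop (𝓝 0) := by
    have := hρe.sub (((tendsto_add_atTop_iff_nat 1).2 hSo).mul hz1')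
    rw [zero_mul, sub_zero] at this
    refine this.congr fun n => ?_
    simp only [hw]
    ring
  have hρw' : Tendsto (fun n => ρ n * w n) atTop (𝓝 0) := by
    have hn := hρw.norm
    rw [norm_zero] at hn
    refine squeeze_zero_norm (fun n => ?_) hn
    rw [norm_mul, norm_mul, Complex.norm_real, Complex.norm_real]
    refine mul_le_mul_of_nonneg_right ?_ (norm_nonneg _)
    rw [Real.norm_of_nonneg (hpos _).le, Real.norm_of_nonneg (hpos _).le]
    exact (hmono n.lt_succ_self).le
  obtain ⟨Z, hZ0, hZ⟩ := exists_norm_le_of_tendsto hz1'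
  obtain ⟨Y, hY0, hY⟩ := exists_norm_le_of_tendsto hρe
  have hwsq : Summable fun n => (ρ (n + 1) - ρ n) * ρ (n + 1) * ‖w n‖ ^ 2 := by
    refine ((hF1.mul_left (2 * (Y * (R * (B * M))))).add
      (hsq.mul_left (2 * Z ^ 2))).of_nonneg_of_le
      (fun n => mul_nonneg (mul_nonneg (hΔ n).le (hpos _).le) (sq_nonneg _)) fun n => ?_
    have h1 : ‖w n‖ ≤ ‖e n‖ + ‖S (n + 1)‖ * Z := by
      refine (norm_sub_le _ _).trans (add_le_add le_rfl ?_)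
      rw [norm_mul]
      exact mul_le_mul_of_nonneg_left (hZ n) (norm_nonneg _)
    have h2 : ‖w n‖ ^ 2 ≤ 2 * ‖e n‖ ^ 2 + 2 * (‖S (n + 1)‖ * Z) ^ 2 := by
      have := pow_le_pow_left₀ (norm_nonneg _) h1 2
      nlinarith [sq_nonneg (‖e n‖ - ‖S (n + 1)‖ * Z)]
    have h3 : ρ (n + 1) * ‖e n‖ ≤ Y := by
      have := hY n
      rwa [norm_mul, Complex.norm_real, Real.norm_of_nonneg (hpos _).le] at this
    -- Only one factor |e| is needed for summation: ρ_{n+1}|e_n| is bounded, and Δρ_n F_n is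
    -- summable by the Hardy inequality.
    have h4 : ρ (n + 1) * ‖e n‖ ^ 2 ≤ Y * (R * (B * M) * F n) := by
      rw [sq, ← mul_assoc]
      exact mul_le_mul h3 (hen n) (norm_nonneg _) hY0
    calc (ρ (n + 1) - ρ n) * ρ (n + 1) * ‖w n‖ ^ 2
        ≤ (ρ (n + 1) - ρ n) * ρ (n + 1) * (2 * ‖e n‖ ^ 2 + 2 * (‖S (n + 1)‖ * Z) ^ 2) :=
          mul_le_mul_of_nonneg_left h2 (mul_nonneg (hΔ n).le (hpos _).le)
      _ = 2 * ((ρ (n + 1) - ρ n) * (ρ (n + 1) * ‖e n‖ ^ 2)) + 2 * Z ^ 2 * g n := by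
          simp only [hg]; ring
      _ ≤ 2 * ((ρ (n + 1) - ρ n) * (Y * (R * (B * M) * F n))) + 2 * Z ^ 2 * g n := by
          have := mul_le_mul_of_nonneg_left h4 (hΔ n).le
          linarith
      _ = _ := by ring
  refine ⟨z', w', hsys, hz1.congr' hzz.symm, hρw'.congr' ?_, ?_⟩
  · filter_upwards [hww] with n hn
    rw [hn]
  · refine Summable.of_norm_bounded_eventually_nat hwsq ?_
    filter_upwards [hww] with n hn
    rw [hn, Real.norm_of_nonneg (mul_nonneg (mul_nonneg (hΔ n).le (hpos _).le) (sq_nonneg _))]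

/-! ### Translation between the difference equation and the system -/

section

variable {r q u v : ℕ → ℝ} {σ y : ℕ → ℂ}

/-- The Casoratian makes the first equation of the system an identity. The second is u_{n+1} times
the perturbed equation minus y_{n+1} times the unperturbed one, so q cancels. -/
theorem isSolution_iff_isSystem (hu : IsSolution r q u) (hpos : ∀ n, 0 < u n)
    (hcas : ∀ n, r n * (v (n + 1) * u n - u (n + 1) * v n) = 1) :
    IsSolution r (fun n => (q n : ℂ) + σ n) y ↔
      IsSystem (fun n => v n / u n) (fun n => σ n * (u n : ℂ) ^ 2) (fun n => y n / u n)
        (fun n => r n * (y (n + 1) * u n - u (n + 1) * y n)) := by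
  have hu0 : ∀ n, (u n : ℂ) ≠ 0 := fun n => by exact_mod_cast (hpos n).ne'
  refine forall_congr' fun n => ?_
  have hfst : y (n + 1) / u (n + 1) - y n / u n =
      ((v (n + 1) / u (n + 1) - v n / u n : ℝ) : ℂ) *
        (r n * (y (n + 1) * u n - u (n + 1) * y n)) := by
    have hc : (r n : ℂ) * (v (n + 1) * u n - u (n + 1) * v n) = 1 := by exact_mod_cast hcas n
    have h0 := hu0 n
    have h1 := hu0 (n + 1)
    push_cast
    field_simp
    linear_combination (-(y (n + 1) * u n - u (n + 1) * y n)) * hc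
  have hun := hu n
  simp only [fwdDiff, smul_eq_mul] at hun
  have hunC : (r (n + 1) : ℂ) * (u (n + 1 + 1) - u (n + 1)) - r n * (u (n + 1) - u n) =
      q (n + 1) * u (n + 1) := by exact_mod_cast hun
  have h1 := hu0 (n + 1)
  simp only [fwdDiff, Complex.real_smul, hfst, true_and]
  rw [show σ (n + 1) * (u (n + 1) : ℂ) ^ 2 * (y (n + 1) / u (n + 1)) =
    σ (n + 1) * u (n + 1) * y (n + 1) by field_simp]
  constructor
  · intro h
    linear_combination (u (n + 1) : ℂ) * h - y (n + 1) * hunC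
  · intro h
    refine mul_left_cancel₀ h1 ?_
    linear_combination h + y (n + 1) * hunC

theorem IsPrincipalPair.strictMono (hr : ∀ n, 0 < r n) (h : IsPrincipalPair r q u v) :
    StrictMono fun n => v n / u n := by
  refine strictMono_nat_of_lt_succ fun n => ?_
  rw [div_lt_div_iff₀ (h.pos_u n) (h.pos_u _)]
  have := h.casoratian n
  by_contra hcon
  nlinarith [hr n]

theorem IsPrincipalPair.tendsto_atTop (h : IsPrincipalPair r q u v) :
    Tendsto (fun n => v n / u n) atTop atTop := by
  have : Tendsto (fun n => u n / v n) atTop (𝓝[>] 0) :=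
    tendsto_nhdsWithin_iff.2 ⟨h.tendsto_ratio,
      Eventually.of_forall fun n => div_pos (h.pos_u n) (h.pos_v n)⟩
  refine (tendsto_inv_nhdsGT_zero.comp this).congr fun n => ?_
  simp

theorem IsPrincipalPair.sub_ratio (hr : ∀ n, 0 < r n) (h : IsPrincipalPair r q u v) (n : ℕ) :
    v (n + 1) / u (n + 1) - v n / u n = 1 / (r n * u n * u (n + 1)) := by
  have h0 := (h.pos_u n).ne'
  have h1 := (h.pos_u (n + 1)).ne'
  have h2 := (hr n).ne'
  have := h.casoratian n
  field_simp
  linear_combination this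

/-- This exact formula turns the little-o condition on consecutive ratios into ρw/z → 0, that is ρw
→ 0 when z → 1. -/
theorem IsPrincipalPair.ratio_sub_div (hr : ∀ n, 0 < r n) (h : IsPrincipalPair r q u v)
    {z w : ℕ → ℂ} {s : ℕ → ℂ} (hs : IsSystem (fun n => v n / u n) s z w) {n : ℕ}
    (hn : z n ≠ 0) :
    (u (n + 1) * z (n + 1) / (u n * z n) - ((u (n + 1) / u n : ℝ) : ℂ)) /
      ((1 / (r n * u n * v n) : ℝ) : ℂ) = ((v n / u n : ℝ) : ℂ) * w n / z n := by
  have h0 : (u n : ℂ) ≠ 0 := by exact_mod_cast (h.pos_u n).ne'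
  have h1 : (u (n + 1) : ℂ) ≠ 0 := by exact_mod_cast (h.pos_u (n + 1)).ne'
  have h2 : (r n : ℂ) ≠ 0 := by exact_mod_cast (hr n).ne'
  have h3 : (v n : ℂ) ≠ 0 := by exact_mod_cast (h.pos_v n).ne'
  have h4 := (hs n).1
  simp only [h.sub_ratio hr] at h4
  rw [show z (n + 1) = z n + ((1 / (r n * u n * u (n + 1)) : ℝ) : ℂ) * w n by rw [← h4]; ring]
  push_cast
  field_simp
  ring

theorem IsPrincipalPair.isLittleO_u_iff (hr : ∀ n, 0 < r n) (h : IsPrincipalPair r q u v)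
    {s z w : ℕ → ℂ} (hs : IsSystem (fun n => v n / u n) s z w) (hz : Tendsto z atTop (𝓝 1)) :
    ((fun n => u (n + 1) * z (n + 1) / (u n * z n) - ((u (n + 1) / u n : ℝ) : ℂ))
      =o[atTop] fun n => 1 / (r n * u n * v n)) ↔
      Tendsto (fun n => ((v n / u n : ℝ) : ℂ) * w n) atTop (𝓝 0) := by
  have hg : ∀ n, ((1 / (r n * u n * v n) : ℝ) : ℂ) ≠ 0 := fun n => by
    exact_mod_cast (one_div_pos.2 (mul_pos (mul_pos (hr n) (h.pos_u n)) (h.pos_v n))).ne'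
  rw [← Complex.isLittleO_ofReal_right, isLittleO_iff_tendsto fun n hn => absurd hn (hg n)]
  have hz0 : ∀ᶠ n in atTop, z n ≠ 0 := hz.eventually_ne one_ne_zero
  constructor
  · intro hl
    have := hl.mul hz
    rw [zero_mul] at this
    refine this.congr' ?_
    filter_upwards [hz0] with n hn
    rw [h.ratio_sub_div hr hs hn, div_mul_cancel₀ _ hn]
  · intro hl
    have := hl.div hz one_ne_zero
    rw [zero_div] at this
    refine this.congr' ?_
    filter_upwards [hz0] with n hn
    rw [h.ratio_sub_div hr hs hn]
    rfl

/-- The ratio v_{n+1}/v_n exceeds u_{n+1}/u_n by exactly 1/(r_n u_n v_n), so the quotient in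
question is ρw/z − 1, which tends to 0. -/
theorem IsPrincipalPair.isLittleO_v (hr : ∀ n, 0 < r n) (h : IsPrincipalPair r q u v)
    {s z w : ℕ → ℂ} (hs : IsSystem (fun n => v n / u n) s z w)
    (hz : Tendsto (fun n => z n / ((v n / u n : ℝ) : ℂ)) atTop (𝓝 1))
    (hw : Tendsto w atTop (𝓝 1)) :
    (fun n => u (n + 1) * z (n + 1) / (u n * z n) - ((v (n + 1) / v n : ℝ) : ℂ))
      =o[atTop] fun n => 1 / (r n * u n * v n) := by
  have hg : ∀ n, ((1 / (r n * u n * v n) : ℝ) : ℂ) ≠ 0 := fun n => by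
    exact_mod_cast (one_div_pos.2 (mul_pos (mul_pos (hr n) (h.pos_u n)) (h.pos_v n))).ne'
  rw [← Complex.isLittleO_ofReal_right, isLittleO_iff_tendsto fun n hn => absurd hn (hg n)]
  have := (hw.div hz one_ne_zero).sub_const 1
  rw [div_one, sub_self] at this
  refine this.congr' ?_
  filter_upwards [hz.eventually_ne one_ne_zero] with n hn
  have hzn : z n ≠ 0 := by rintro h0; simp [h0] at hn
  have h0 : (u n : ℂ) ≠ 0 := by exact_mod_cast (h.pos_u n).ne'
  have h2 : (r n : ℂ) ≠ 0 := by exact_mod_cast (hr n).ne'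
  have h3 : (v n : ℂ) ≠ 0 := by exact_mod_cast (h.pos_v n).ne'
  have hvu : v (n + 1) / v n = u (n + 1) / u n + 1 / (r n * u n * v n) := by
    have h0 := (h.pos_u n).ne'
    have h2 := (hr n).ne'
    have h3 := (h.pos_v n).ne'
    have := h.casoratian n
    field_simp
    linear_combination this
  rw [hvu, Complex.ofReal_add, ← sub_sub, sub_div, div_self (hg n), h.ratio_sub_div hr hs hzn]
  simp only [Pi.div_apply]
  push_cast
  field_simp

theorem IsPrincipalPair.sq_term_eq (hr : ∀ n, 0 < r n) (h : IsPrincipalPair r q u v)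
    {s z w : ℕ → ℂ} (hs : IsSystem (fun n => v n / u n) s z w) (n : ℕ) :
    r n * u n * v (n + 1) * ‖z (n + 1) - z n‖ ^ 2 =
      (v (n + 1) / u (n + 1) - v n / u n) * (v (n + 1) / u (n + 1)) * ‖w n‖ ^ 2 := by
  have hpos : 0 < 1 / (r n * u n * u (n + 1)) :=
    one_div_pos.2 (mul_pos (mul_pos (hr n) (h.pos_u n)) (h.pos_u _))
  have h0 := (h.pos_u n).ne'
  have h1 := (h.pos_u (n + 1)).ne'
  have h2 := (hr n).ne'
  rw [(hs n).1]
  simp only [h.sub_ratio hr]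
  rw [norm_mul, Complex.norm_real, Real.norm_of_nonneg hpos.le]
  field_simp

theorem IsPrincipalPair.one_div_eq (hr : ∀ n, 0 < r n) (h : IsPrincipalPair r q u v) (n : ℕ) :
    1 / (r n * u n * v (n + 1)) =
      (v (n + 1) / u (n + 1) - v n / u n) / (v (n + 1) / u (n + 1)) := by
  have h0 := (h.pos_u n).ne'
  have h1 := (h.pos_u (n + 1)).ne'
  have h2 := (hr n).ne'
  have h3 := (h.pos_v (n + 1)).ne'
  rw [h.sub_ratio hr]
  field_simp

/-- When `J` converges, the sequences `J_n` and `C_n = ρ_n S_n` satisfy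
`J_n - C_n = ∑_{k ≥ n} C_{k+1} / (r_k u_k v_{k+1})`. -/
theorem IsPrincipalPair.exists_tail (hr : ∀ n, 0 < r n) (h : IsPrincipalPair r q u v)
    (hJ : ConvergesJ σ u v) :
    ∃ S : ℕ → ℂ, (∀ n, S n - S (n + 1) = σ n * (u n : ℂ) ^ 2) ∧
      Tendsto (fun n => ((v n / u n : ℝ) : ℂ) * S n) atTop (𝓝 0) ∧
      (∀ n, C σ u v n = ((v n / u n : ℝ) : ℂ) * S n) ∧
      IsTail (fun n => J σ u v n - C σ u v n)
        (fun n => ((1 / (r n * u n * v (n + 1)) : ℝ) : ℂ) * C σ u v (n + 1)) := by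
  obtain ⟨F, hF⟩ := summable_conditional_iff.1 hJ
  have hFJ : ∀ n, J σ u v n = F n := fun n => (hF.hasSum n).tsum_eq
  have hterm : ∀ n, ((v n / u n : ℝ) : ℂ) * (σ n * (u n : ℂ) ^ 2) = σ n * u n * v n := fun n => by
    have h0 : (u n : ℂ) ≠ 0 := by exact_mod_cast (h.pos_u n).ne'
    push_cast
    field_simp
  have hF' : IsTail F fun n => ((v n / u n : ℝ) : ℂ) * (σ n * (u n : ℂ) ^ 2) := by
    simpa only [hterm] using hF
  obtain ⟨S, hS, hSo⟩ := exists_tail_of_weighted (fun n => div_pos (h.pos_v n) (h.pos_u n))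
    (h.strictMono hr) h.tendsto_atTop hF'
  have hC : ∀ n, C σ u v n = ((v n / u n : ℝ) : ℂ) * S n := fun n => by
    rw [C, (hS.hasSum n).tsum_eq]
  refine ⟨S, hS.1, hSo, hC, fun n => ?_, ?_⟩
  · have h0 : (u n : ℂ) ≠ 0 := by exact_mod_cast (h.pos_u n).ne'
    have h1 : (u (n + 1) : ℂ) ≠ 0 := by exact_mod_cast (h.pos_u (n + 1)).ne'
    have h3 : (v (n + 1) : ℂ) ≠ 0 := by exact_mod_cast (h.pos_v (n + 1)).ne'
    have e1 := hF'.1 n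
    have e2 := hS.1 n
    beta_reduce at e1 e2 ⊢
    rw [← e2] at e1
    rw [h.one_div_eq hr, hFJ, hFJ, hC, hC]
    have e3 : (((v (n + 1) / u (n + 1) - v n / u n) / (v (n + 1) / u (n + 1)) : ℝ) : ℂ) *
        (((v (n + 1) / u (n + 1) : ℝ) : ℂ) * S (n + 1)) =
        ((v (n + 1) / u (n + 1) : ℝ) - (v n / u n : ℝ) : ℂ) * S (n + 1) := by
      push_cast
      field_simp
    rw [e3]
    linear_combination e1
  · simp only [hFJ, hC]
    simpa using hF.2.sub hSo

theorem IsPrincipalPair.convergesG_iff (hr : ∀ n, 0 < r n) (h : IsPrincipalPair r q u v)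
    {S : ℕ → ℂ} (hC : ∀ n, C σ u v n = ((v n / u n : ℝ) : ℂ) * S n) :
    ConvergesG r σ u v ↔ Summable fun n =>
      (v (n + 1) / u (n + 1) - v n / u n) * (v (n + 1) / u (n + 1)) * ‖S (n + 1)‖ ^ 2 := by
  refine summable_congr fun n => ?_
  have hp := div_pos (h.pos_v (n + 1)) (h.pos_u (n + 1))
  rw [div_eq_mul_one_div, h.one_div_eq hr, hC, norm_mul, Complex.norm_real,
    Real.norm_of_nonneg hp.le]
  have := hp.ne'
  generalize v (n + 1) / u (n + 1) = a at *
  field_simp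

/-- The weight 1/(r_n u_n v_{n+1}) equals Δρ_n/ρ_{n+1}, which lies in [0, 1]. -/
theorem IsPrincipalPair.convergesL_iff_convergesG (hr : ∀ n, 0 < r n)
    (h : IsPrincipalPair r q u v) (hJ : ConvergesJ σ u v) :
    ConvergesL r σ u v ↔ ConvergesG r σ u v := by
  obtain ⟨S, -, -, -, hD⟩ := h.exists_tail hr hJ
  have hpos : ∀ n, 0 < r n * u n * v (n + 1) := fun n =>
    mul_pos (mul_pos (hr n) (h.pos_u n)) (h.pos_v _)
  have := summable_re_mul_conj_iff (δ := fun n => 1 / (r n * u n * v (n + 1)))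
    (fun n => (one_div_pos.2 (hpos n)).le) (fun n => ?_) hD
  · simpa only [ConvergesL, ConvergesG, mul_one_div] using this
  · rw [h.one_div_eq hr]
    exact (div_le_one (div_pos (h.pos_v _) (h.pos_u _))).2
      (sub_le_self _ (div_pos (h.pos_v _) (h.pos_u _)).le)

theorem IsPrincipalPair.convergesJ_and_convergesG (hr : ∀ n, 0 < r n)
    (h : IsPrincipalPair r q u v) (hsol : NarrowProblemSolvable r q σ u v) :
    ConvergesJ σ u v ∧ ConvergesG r σ u v := by
  obtain ⟨u', v', hfs, has, hsum⟩ := hsol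
  have hsys := (isSolution_iff_isSystem h.sol_u h.pos_u h.casoratian).1 hfs.sol_u
  have hpos : ∀ n, 0 < v n / u n := fun n => div_pos (h.pos_v n) (h.pos_u n)
  have hu' : ∀ n, (u n : ℂ) * (u' n / u n) = u' n := fun n =>
    mul_div_cancel₀ _ (by exact_mod_cast (h.pos_u n).ne')
  have hw := (h.isLittleO_u_iff hr hsys has.tendsto_u).1 (by
    simpa only [hu'] using has.isLittleO_u)
  simp only [h.sq_term_eq hr hsys] at hsum
  have hJ : ConvergesJ σ u v := by
    refine (hsys.summable_weighted hpos (h.strictMono hr) has.tendsto_u hw hsum).congr fun n => ?_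
    have h0 : (u n : ℂ) ≠ 0 := by exact_mod_cast (h.pos_u n).ne'
    push_cast
    field_simp
  obtain ⟨S, hS, hSo, hC, -⟩ := h.exists_tail hr hJ
  exact ⟨hJ, (h.convergesG_iff hr hC).2
    (hsys.summable_sq_tail hpos (h.strictMono hr) has.tendsto_u hw hsum hS hSo)⟩

theorem IsPrincipalPair.isSolution_mul (h : IsPrincipalPair r q u v) (hr : ∀ n, 0 < r n)
    {z w : ℕ → ℂ}
    (hs : IsSystem (fun n => v n / u n) (fun n => σ n * (u n : ℂ) ^ 2) z w) :
    IsSolution r (fun n => (q n : ℂ) + σ n) fun n => u n * z n := by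
  rw [isSolution_iff_isSystem h.sol_u h.pos_u h.casoratian]
  have hz : (fun n => u n * z n / (u n : ℂ)) = z := funext fun n =>
    mul_div_cancel_left₀ _ (by exact_mod_cast (h.pos_u n).ne')
  have hw : (fun n => r n * (u (n + 1) * z (n + 1) * u n - u (n + 1) * (u n * z n)) : ℕ → ℂ) =
      w := funext fun n => by
    have h0 : (u n : ℂ) ≠ 0 := by exact_mod_cast (h.pos_u n).ne'
    have h1 : (u (n + 1) : ℂ) ≠ 0 := by exact_mod_cast (h.pos_u (n + 1)).ne'
    have h2 : (r n : ℂ) ≠ 0 := by exact_mod_cast (hr n).ne'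
    have h4 := (hs n).1
    simp only [h.sub_ratio hr] at h4
    rw [show z (n + 1) = z n + ((1 / (r n * u n * u (n + 1)) : ℝ) : ℂ) * w n by rw [← h4]; ring]
    push_cast
    field_simp
    ring
  rw [hz, hw]
  exact hs

theorem IsPrincipalPair.narrowProblemSolvable (hr : ∀ n, 0 < r n)
    (h : IsPrincipalPair r q u v) (hJ : ConvergesJ σ u v) (hG : ConvergesG r σ u v) :
    NarrowProblemSolvable r q σ u v := by
  obtain ⟨S, hS, hSo, hC, hD⟩ := h.exists_tail hr hJ
  have hpos : ∀ n, 0 < v n / u n := fun n => div_pos (h.pos_v n) (h.pos_u n)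
  have hmono := h.strictMono hr
  have hu0 : ∀ n, (u n : ℂ) ≠ 0 := fun n => by exact_mod_cast (h.pos_u n).ne'
  have hD' : IsTail (fun n => J σ u v n - C σ u v n) fun n =>
      ((v (n + 1) / u (n + 1) - v n / u n : ℝ) : ℂ) * S (n + 1) := by
    refine ⟨fun n => (hD.1 n).trans ?_, hD.2⟩
    have h1 := hu0 (n + 1)
    have h3 : (v (n + 1) : ℂ) ≠ 0 := by exact_mod_cast (h.pos_v (n + 1)).ne'
    beta_reduce
    rw [h.one_div_eq hr, hC]
    push_cast
    field_simp
  obtain ⟨z, w, hs, hz, hw, hsq⟩ :=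
    exists_recessive hpos hmono hS hSo hD' ((h.convergesG_iff hr hC).1 hG)
  obtain ⟨z₂, w₂, hs₂, hz₂, hw₂, hcas⟩ := hs.exists_dominant hmono h.tendsto_atTop hz hw
  refine ⟨fun n => u n * z n, fun n => u n * z₂ n,
    ⟨h.isSolution_mul hr hs, h.isSolution_mul hr hs₂, ?_⟩, ⟨?_, ?_, ?_, ?_⟩, ?_⟩
  · rw [LinearIndependent.pair_iff]
    intro a b hab
    have hz0 : ∀ n, a * z n + b * z₂ n = 0 := fun n => by
      have := congrFun hab n
      simp only [Pi.add_apply, Pi.smul_apply, smul_eq_mul, Pi.zero_apply] at this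
      exact mul_left_cancel₀ (hu0 n) (by linear_combination this)
    -- Differencing the relation between z and z₂ and dividing by Δρ_0 ≠ 0 gives the same relation
    -- between w and w₂; Casoratian 1 then forces a = b = 0.
    have hw0 : a * w 0 + b * w₂ 0 = 0 := by
      have hΔ : ((v (0 + 1) / u (0 + 1) - v 0 / u 0 : ℝ) : ℂ) ≠ 0 := by
        exact_mod_cast (sub_pos.2 (hmono (Nat.lt_succ_self 0))).ne'
      refine mul_left_cancel₀ hΔ ?_
      linear_combination hz0 (0 + 1) - hz0 0 - a * (hs 0).1 - b * (hs₂ 0).1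
    have hc := hcas 0
    constructor
    · linear_combination (-a) * hc + w₂ 0 * hz0 0 - z₂ 0 * hw0
    · linear_combination (-b) * hc - w 0 * hz0 0 + z 0 * hw0
  · refine hz.congr fun n => ?_
    rw [mul_div_cancel_left₀ _ (hu0 n)]
  · refine hz₂.congr fun n => ?_
    have h0 := hu0 n
    have h3 : (v n : ℂ) ≠ 0 := by exact_mod_cast (h.pos_v n).ne'
    push_cast
    field_simp
  · exact (h.isLittleO_u_iff hr hs hz).2 hw
  · exact h.isLittleO_v hr hs₂ hz₂ hw₂
  · refine hsq.congr fun n => ?_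
    rw [← h.sq_term_eq hr hs, mul_div_cancel_left₀ _ (hu0 n), mul_div_cancel_left₀ _ (hu0 (n + 1))]

end

end HartmanWintner

theorem theorem1p3 (r q : ℕ → ℝ) (σ : ℕ → ℂ) (u v : ℕ → ℝ)
    (hr : ∀ n, 0 < r n) (huv : HartmanWintner.IsPrincipalPair r q u v) :
    HartmanWintner.NarrowProblemSolvable r q σ u v ↔
      HartmanWintner.ConvergesJ σ u v ∧
        (HartmanWintner.ConvergesG r σ u v ∨ HartmanWintner.ConvergesL r σ u v) := by
  constructor
  · intro h
    obtain ⟨hJ, hG⟩ := huv.convergesJ_and_convergesG hr h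
    exact ⟨hJ, Or.inl hG⟩
  · rintro ⟨hJ, hG | hL⟩
    · exact huv.narrowProblemSolvable hr hJ hG
    · exact huv.narrowProblemSolvable hr hJ ((huv.convergesL_iff_convergesG hr hJ).1 hL)
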